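/- Let $q\in\mathbb C\setminus\{0\}$ be generic, i.e. $q^k\neq 1$ for all $k\ge 1$; put $\omega=q-q^{-1}$ and $k_q=(q^k-q^{-k})/(q-q^{-1})$. Let $V=\mathbb C^N$ and let $R\in\mathrm{End}(V^{\otimes 2})$ be a Hecke symmetry, i.e. $R_1R_2R_1=R_2R_1R_2$ on $V^{\otimes 3}$ and $(q-R)(q^{-1}+R)=0$, where $R_i$ denotes $R$ acting in the tensor factors $i,i+1$. Assume that * $R$ is skew-invertible: there is $\Psi\in\mathrm{End}(V^{\otimes 2})$ with $\mathrm{Tr}_{(2)}(R_{12}\Psi_{23})=P_{13}=\mathrm{Tr}_{(2)}(\Psi_{12}R_{23})$, $P$ being the flip; put $C=\mathrm{Tr}_{(2)}\Psi$; * $R$ is even of bi-rank $(m|0)$: the Hilbert–Poincaré series of the $R$-skew-symmetric algebra $T(V)/\langle \mathrm{Im}(q^{-1}+R)\rangle$ is a polynomial of degree $m$. Let $\mathcal L(R)$ be the reflection equation algebra, the unital associative $\mathbb C$-algebra generated by the entries of the $N\times N$ matrix $L=\|l_i^j\|$ subject to $R(L\otimes I)R(L\otimes I)=(L\otimes I)R(L\otimes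 I)R$. Put $L_{\overline 1}=L\otimes I\otimes\cdots\otimes I$, $L_{\overline{k+1}}=R_kL_{\overline k}R_k^{-1}$, and $\langle Z\rangle_{1\dots k}=\mathrm{Tr}_{(1\dots k)}(C_1\cdots C_kZ)$, where $C_i$ is $C$ acting in the $i$-th factor. Let $$p_k=\langle R_{k-1}\cdots R_1L_{\overline 1}\cdots L_{\overline k}\rangle_{1\dots k},\qquad t_k=\langle R_{k-1}^{-1}\cdots R_1^{-1}L_{\overline 1}\cdots L_{\overline k}\rangle_{1\dots k},\qquad a_k=\langle A^{(k)}L_{\overline 1}\cdots L_{\overline k}\rangle_{1\dots k}\qquad(k\ge1)$$ be the power sums of the first and of the second kind and the elementary symmetric polynomials, where $A^{(k)}$ is the $q$-antisymmetrizer, i.e. the image in $\mathrm{End}(V^{\otimes k})$ of the primitive idempotent of the Hecke algebra attached to the partition $(1^k)$: $A^{(1)}=1$, $A^{(k+1)}=\frac1{(k+1)_q}A^{(k)}\bigl(q^k-k_qR_k\bigr)A^{(k)}$. Put $P(x)=\sum_{k\ge1}p_kx^k$ and $T(x)=\sum_{k\ge1}t_kx^k$. Let $E$ be a unital associative $\mathbb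 C$-algebra with a homomorphism $\mathcal L(R)\to E$, and let $\mu_1,\dots,\mu_m$ be spectral values of $L$ in $E$: central elements of $E$ such that $$q^ka_k=\sum_{1\le i_1<\dots<i_k\le m}\mu_{i_1}\cdots\mu_{i_k}\quad\text{in }E,\qquad 1\le k\le m$$ (for instance, $E=\mathcal L(R)[\mu_1,\dots,\mu_m]$, the algebra obtained from $\mathcal L(R)$ by adjoining central elements $\mu_i$ subject to these relations). Then the following identities of formal power series in $x$ hold over $E$ (the coefficients of $P$ and $T$ being replaced by their images in $E$): $$1+\omega P(x)=\prod_{i=1}^m\frac{1-q^{-2}\mu_ix}{1-\mu_ix},\qquad 1-\omega T(x)=\prod_{i=1}^m\frac{1-\mu_ix}{1-q^{-2}\mu_ix}.$$ -/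

import Mathlib

open scoped Kronecker

namespace ReflectionEq

noncomputable section

/-! ### Matrices acting on tensor powers

A matrix on `V^{⊗n}`, where `V = ℂ^N`, has rows and columns indexed by `Fin n → Fin N`;
tensor factors are numbered `0, …, n - 1`. -/

/-- The matrix on `V^{⊗n}` that acts as `M` in the `i`-th factor and as the identity elsewhere. -/
def oneSite {S : Type*} [Zero S] {N n : ℕ} (i : Fin n) (M : Matrix (Fin N) (Fin N) S) :
    Matrix (Fin n → Fin N) (Fin n → Fin N) S :=
  Matrix.of fun v w => if ∀ k, k ≠ i → v k = w k then M (v i) (w i) else 0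

/-- The matrix on `V^{⊗(n+1)}` that acts as `M` in the neighbouring factors `i`, `i + 1`
and as the identity elsewhere. -/
def twoSite {S : Type*} [Zero S] {N n : ℕ} (i : Fin n)
    (M : Matrix (Fin N × Fin N) (Fin N × Fin N) S) :
    Matrix (Fin (n + 1) → Fin N) (Fin (n + 1) → Fin N) S :=
  Matrix.of fun v w =>
    if ∀ k, k ≠ i.castSucc → k ≠ i.succ → v k = w k then
      M (v i.castSucc, v i.succ) (w i.castSucc, w i.succ) else 0

/-- The tensor power `C^{⊗n} = C_1 C_2 ⋯ C_n` of an `N × N` matrix `C`. -/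
def tensorPow {N : ℕ} (C : Matrix (Fin N) (Fin N) ℂ) (n : ℕ) :
    Matrix (Fin n → Fin N) (Fin n → Fin N) ℂ :=
  Matrix.of fun v w => ∏ k, C (v k) (w k)

/-- The `q`-number `k_q = (q^k - q^{-k}) / (q - q^{-1})`. -/
def qNum (q : ℂ) (k : ℕ) : ℂ := (q ^ k - (q⁻¹) ^ k) / (q - q⁻¹)

/-! ### Hecke symmetries -/

/-- A Hecke symmetry: a solution of the braid relation `R₁₂ R₂₃ R₁₂ = R₂₃ R₁₂ R₂₃` on `V^{⊗3}`
satisfying the Hecke condition `(q - R)(q⁻¹ + R) = 0`. -/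
structure IsHeckeSymmetry {N : ℕ} (q : ℂ) (R : Matrix (Fin N × Fin N) (Fin N × Fin N) ℂ) :
    Prop where
  braid : twoSite (0 : Fin 2) R * twoSite (1 : Fin 2) R * twoSite (0 : Fin 2) R =
    twoSite (1 : Fin 2) R * twoSite (0 : Fin 2) R * twoSite (1 : Fin 2) R
  hecke : (q • (1 : Matrix (Fin N × Fin N) (Fin N × Fin N) ℂ) - R) *
    (q⁻¹ • (1 : Matrix (Fin N × Fin N) (Fin N × Fin N) ℂ) + R) = 0

/-- `Ψ` is the skew-inverse of `R`: `Tr_(2) (R₁₂ Ψ₂₃) = P₁₃ = Tr_(2) (Ψ₁₂ R₂₃)`, where `P` is the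
flip and the trace is over the middle factor of `V^{⊗3}`; both equalities are written for the
matrix element with row `(i, k)` and column `(i', k')` in the factors 1 and 3. -/
structure IsSkewInverse {N : ℕ} (R Ψ : Matrix (Fin N × Fin N) (Fin N × Fin N) ℂ) : Prop where
  left : ∀ i k i' k' : Fin N, ∑ a, ∑ b, R (i, a) (i', b) * Ψ (b, k) (a, k') =
    if i = k' ∧ k = i' then 1 else 0
  right : ∀ i k i' k' : Fin N, ∑ a, ∑ b, Ψ (i, a) (i', b) * R (b, k) (a, k') =
    if i = k' ∧ k = i' then 1 else 0

/-- The matrix `C = Tr_(2) Ψ` defining the `R`-trace. -/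
def traceMatrix {N : ℕ} (Ψ : Matrix (Fin N × Fin N) (Fin N × Fin N) ℂ) :
    Matrix (Fin N) (Fin N) ℂ :=
  Matrix.of fun i j => ∑ a, Ψ (i, a) (j, a)

/-! ### The `R`-skew-symmetric algebra and the bi-rank -/

/-- The generators of the ideal `⟨Im (q⁻¹ + R)⟩` of the tensor algebra of `V` (the free algebra on
the basis vectors of `V`), set equal to `0`. -/
inductive SkewRel {N : ℕ} (q : ℂ) (R : Matrix (Fin N × Fin N) (Fin N × Fin N) ℂ) :
    FreeAlgebra ℂ (Fin N) → FreeAlgebra ℂ (Fin N) → Prop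
  | of (j : Fin N × Fin N) : SkewRel q R
      (∑ i : Fin N × Fin N,
        (q⁻¹ • (1 : Matrix (Fin N × Fin N) (Fin N × Fin N) ℂ) + R) i j •
          (FreeAlgebra.ι ℂ i.1 * FreeAlgebra.ι ℂ i.2)) 0

/-- The `R`-skew-symmetric algebra `T(V) / ⟨Im (q⁻¹ + R)⟩`. -/
abbrev SkewAlgebra {N : ℕ} (q : ℂ) (R : Matrix (Fin N × Fin N) (Fin N × Fin N) ℂ) : Type :=
  RingQuot (SkewRel q R)

/-- The homogeneous component of degree `k` of the `R`-skew-symmetric algebra: the span of the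
products of `k` generators. -/
def skewComponent {N : ℕ} (q : ℂ) (R : Matrix (Fin N × Fin N) (Fin N × Fin N) ℂ) (k : ℕ) :
    Submodule ℂ (SkewAlgebra q R) :=
  (Submodule.span ℂ (Set.range fun i : Fin N =>
    RingQuot.mkAlgHom ℂ (SkewRel q R) (FreeAlgebra.ι ℂ i))) ^ k

/-- The Hilbert–Poincaré series of the `R`-skew-symmetric algebra. -/
def skewHilbertSeries {N : ℕ} (q : ℂ) (R : Matrix (Fin N × Fin N) (Fin N × Fin N) ℂ) :
    PowerSeries ℕ :=
  PowerSeries.mk fun k => Module.finrank ℂ (skewComponent q R k)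

/-- `R` is even of bi-rank `(m|0)`: the Hilbert–Poincaré series of the `R`-skew-symmetric algebra
is a polynomial of degree `m`. -/
def HasBiRank {N : ℕ} (q : ℂ) (R : Matrix (Fin N × Fin N) (Fin N × Fin N) ℂ) (m : ℕ) : Prop :=
  ∃ H : Polynomial ℕ, H.natDegree = m ∧ (H : PowerSeries ℕ) = skewHilbertSeries q R

/-! ### The reflection equation algebra -/

/-- The generic matrix `L ⊗ I` on `V^{⊗2}` over the free algebra on the symbols `l_{ij}`. -/
def freeL (N : ℕ) :
    Matrix (Fin N × Fin N) (Fin N × Fin N) (FreeAlgebra ℂ (Fin N × Fin N)) :=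
  (Matrix.of fun i j : Fin N => FreeAlgebra.ι ℂ (i, j)) ⊗ₖ
    (1 : Matrix (Fin N) (Fin N) (FreeAlgebra ℂ (Fin N × Fin N)))

/-- The defining relations `R (L ⊗ I) R (L ⊗ I) = (L ⊗ I) R (L ⊗ I) R`, entry by entry. -/
inductive RERel {N : ℕ} (R : Matrix (Fin N × Fin N) (Fin N × Fin N) ℂ) :
    FreeAlgebra ℂ (Fin N × Fin N) → FreeAlgebra ℂ (Fin N × Fin N) → Prop
  | of (i j : Fin N × Fin N) : RERel R
      ((R.map (algebraMap ℂ (FreeAlgebra ℂ (Fin N × Fin N))) * freeL N *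
        R.map (algebraMap ℂ (FreeAlgebra ℂ (Fin N × Fin N))) * freeL N) i j)
      ((freeL N * R.map (algebraMap ℂ (FreeAlgebra ℂ (Fin N × Fin N))) * freeL N *
        R.map (algebraMap ℂ (FreeAlgebra ℂ (Fin N × Fin N)))) i j)

/-- The reflection equation algebra `𝓛(R)`. -/
abbrev REAlgebra {N : ℕ} (R : Matrix (Fin N × Fin N) (Fin N × Fin N) ℂ) : Type :=
  RingQuot (RERel R)

/-- The generating matrix `L` of `𝓛(R)`. -/
def genL {N : ℕ} (R : Matrix (Fin N × Fin N) (Fin N × Fin N) ℂ) :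
    Matrix (Fin N) (Fin N) (REAlgebra R) :=
  Matrix.of fun i j => RingQuot.mkAlgHom ℂ (RERel R) (FreeAlgebra.ι ℂ (i, j))

/-- A complex matrix regarded as a matrix over `𝓛(R)`. -/
def scal {N : ℕ} (R : Matrix (Fin N × Fin N) (Fin N × Fin N) ℂ) {ι : Type*}
    (M : Matrix ι ι ℂ) : Matrix ι ι (REAlgebra R) :=
  M.map (algebraMap ℂ (REAlgebra R))

/-- The copies of `L` on `V^{⊗(n+1)}`: `L` in the first factor, and then
`L̄_{k+1} = R_k L̄_k R_k⁻¹`. -/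
def barL {N : ℕ} (R : Matrix (Fin N × Fin N) (Fin N × Fin N) ℂ) (n : ℕ) :
    Fin (n + 1) → Matrix (Fin (n + 1) → Fin N) (Fin (n + 1) → Fin N) (REAlgebra R) :=
  Fin.induction (motive := fun _ =>
      Matrix (Fin (n + 1) → Fin N) (Fin (n + 1) → Fin N) (REAlgebra R))
    (oneSite 0 (genL R))
    (fun i X => scal R (twoSite i R) * X * scal R (twoSite i R⁻¹))

/-- The ordered product `L̄_1 L̄_2 ⋯ L̄_{n+1}` on `V^{⊗(n+1)}`. -/
def barLProd {N : ℕ} (R : Matrix (Fin N × Fin N) (Fin N × Fin N) ℂ) (n : ℕ) :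
    Matrix (Fin (n + 1) → Fin N) (Fin (n + 1) → Fin N) (REAlgebra R) :=
  (List.ofFn (barL R n)).prod

/-- The element `⟨Z L̄_1 ⋯ L̄_{n+1}⟩_{1…n+1} = Tr (C_1 ⋯ C_{n+1} Z L̄_1 ⋯ L̄_{n+1})` of `𝓛(R)`
attached to a complex matrix `Z` on `V^{⊗(n+1)}` (the image of an element of the Hecke algebra). -/
def charElt {N : ℕ} (R Ψ : Matrix (Fin N × Fin N) (Fin N × Fin N) ℂ) {n : ℕ}
    (Z : Matrix (Fin (n + 1) → Fin N) (Fin (n + 1) → Fin N) ℂ) : REAlgebra R :=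
  Matrix.trace (scal R (tensorPow (traceMatrix Ψ) (n + 1)) * (scal R Z * barLProd R n))

/-- The power sums of the first kind, `p_k = ⟨R_{k-1} ⋯ R_1 L̄_1 ⋯ L̄_k⟩` for `k ≥ 1`
(the value at `0` is set to `0`, so that it does not contribute to the generating function). -/
def powerSum {N : ℕ} (R Ψ : Matrix (Fin N × Fin N) (Fin N × Fin N) ℂ) : ℕ → REAlgebra R
  | 0 => 0
  | n + 1 => charElt R Ψ (List.ofFn fun i : Fin n => twoSite i R).reverse.prod

/-- The power sums of the second kind, `t_k = ⟨R_{k-1}⁻¹ ⋯ R_1⁻¹ L̄_1 ⋯ L̄_k⟩` for `k ≥ 1`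
(the value at `0` is set to `0`, so that it does not contribute to the generating function). -/
def powerSum' {N : ℕ} (R Ψ : Matrix (Fin N × Fin N) (Fin N × Fin N) ℂ) : ℕ → REAlgebra R
  | 0 => 0
  | n + 1 => charElt R Ψ (List.ofFn fun i : Fin n => twoSite i R⁻¹).reverse.prod

/-- The `q`-antisymmetrizers `A^(1), …, A^(n+1)` on `V^{⊗(n+1)}`, i.e. the images of the primitive
idempotents of the Hecke algebras attached to the one-column partitions `(1^k)`, on which every
`R_i` acts as `-q⁻¹`: `A^(1) = 1` and
`A^(k+1) = ((k+1)_q)⁻¹ A^(k) (q^k - k_q R_k) A^(k)`. The index `i` stands for `A^(i+1)`. -/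
def antisymm {N : ℕ} (q : ℂ) (R : Matrix (Fin N × Fin N) (Fin N × Fin N) ℂ) (n : ℕ) :
    Fin (n + 1) → Matrix (Fin (n + 1) → Fin N) (Fin (n + 1) → Fin N) ℂ :=
  Fin.induction (motive := fun _ => Matrix (Fin (n + 1) → Fin N) (Fin (n + 1) → Fin N) ℂ)
    1
    (fun i A => (qNum q (i.val + 2))⁻¹ •
      (A * (q ^ (i.val + 1) • (1 : Matrix (Fin (n + 1) → Fin N) (Fin (n + 1) → Fin N) ℂ) -
        qNum q (i.val + 1) • twoSite i R) * A))

/-- The elementary symmetric polynomials `a_k = ⟨A^(k) L̄_1 ⋯ L̄_k⟩`, with `a_0 = 1`. -/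
def elemSymm {N : ℕ} (q : ℂ) (R Ψ : Matrix (Fin N × Fin N) (Fin N × Fin N) ℂ) :
    ℕ → REAlgebra R
  | 0 => 1
  | n + 1 => charElt R Ψ (antisymm q R n (Fin.last n))

/-- The generating function `P(x) = ∑_{k ≥ 1} p_k x^k`. -/
def genP {N : ℕ} (R Ψ : Matrix (Fin N × Fin N) (Fin N × Fin N) ℂ) :
    PowerSeries (REAlgebra R) :=
  PowerSeries.mk (powerSum R Ψ)

/-- The generating function `T(x) = ∑_{k ≥ 1} t_k x^k`. -/
def genT {N : ℕ} (R Ψ : Matrix (Fin N × Fin N) (Fin N × Fin N) ℂ) :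
    PowerSeries (REAlgebra R) :=
  PowerSeries.mk (powerSum' R Ψ)

/-- Central elements `μ_1, …, μ_m` of an algebra `E` over `𝓛(R)` are spectral values of `L` if
`q^k a_k(L) = ∑_{i_1 < ⋯ < i_k} μ_{i_1} ⋯ μ_{i_k}` in `E` for `1 ≤ k ≤ m`. -/
def IsSpectrum {N m : ℕ} (q : ℂ) (R Ψ : Matrix (Fin N × Fin N) (Fin N × Fin N) ℂ)
    {E : Type*} [Ring E] [Algebra ℂ E] (φ : REAlgebra R →ₐ[ℂ] E)
    (μ : Fin m → Subalgebra.center ℂ E) : Prop :=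
  ∀ k : ℕ, 1 ≤ k → k ≤ m →
    φ (q ^ k • elemSymm q R Ψ k) =
      ((∑ s ∈ Finset.powersetCard k (Finset.univ : Finset (Fin m)), ∏ i ∈ s, μ i :
        Subalgebra.center ℂ E) : E)

/-- The formal power series `1 - a x`. -/
def lin {K : Type*} [CommRing K] (a : K) : PowerSeries K :=
  1 - PowerSeries.C a * PowerSeries.X

/-- The formal power series `(1 - a x)⁻¹`. -/
def linInv {K : Type*} [CommRing K] (a : K) : PowerSeries K :=
  PowerSeries.invOfUnit (lin a) 1

theorem lin_mul_linInv {K : Type*} [CommRing K] (a : K) : lin a * linInv a = 1 :=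
  PowerSeries.mul_invOfUnit _ _ (by simp [lin])

end

end ReflectionEq

/-!
The tensor powers of `V` are treated all at once: every operator acts on functions of infinite
words, `R_i` through the letters `i, i + 1`, and `⟨·⟩_{1…k}` is an iterated trace, one letter at a
time, weighted by `C`. Skew-invertibility makes the trace of `R_k Z R_k⁻¹` over the letter `k + 1`
equal to that of `Z` over the letter `k`, so moving a bracket to the right does not change it, and
`C ⊗ C` commutes with `R`, so the generators can be moved cyclically inside a bracket.

Inserting the recursion for `A^(i+1)` into `⟨A^(i+1) R_{k-1} ⋯ R_{i+1} L̄_1 ⋯ L̄_k⟩` gives the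
product `a_i p_{k-i}` of two brackets and the same expression for `i - 1`, since idempotency of
`A^(i)` and cyclicity turn `A^(i) R_i A^(i)` into `A^(i) R_i`. Descending in `i` yields the Newton
identities `k_q a_k = ∑_{i < k} (-1)^{k-1-i} q^i a_i p_{k-i}`. The recursion can equally be written
with `q⁻¹` and `R_i⁻¹`, which gives the same identities with `q^{-i}` and `t_{k-i}`.

A row of `A^(k)` is a linear functional on `V^{⊗k}` vanishing on the relations of the
skew-symmetric algebra, so `a_k = 0` for `k > m`. Hence `q^k a_k = e_k(μ)` for every `k`, and, as
`ω k_q = q^k - q^{-k}`, the Newton identities say coefficientwise that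
`∏ (1 - μ_i x) ω P = ∏ (1 - q⁻² μ_i x) - ∏ (1 - μ_i x)` and
`∏ (1 - q⁻² μ_i x) ω T = ∏ (1 - q⁻² μ_i x) - ∏ (1 - μ_i x)`.
-/

namespace ReflectionEq

open Finset
open scoped Matrix

/-! ### Matrix units and partial traces -/

section MatrixUnits

variable {𝕜 n A : Type*} [Fintype n] [CommSemiring 𝕜] [Semiring A] [Algebra 𝕜 A]

/-- A system of matrix units `u a b` in a ring: the images of the elementary matrices under a
unital homomorphism from the matrix ring. -/
structure IsMatrixUnits [DecidableEq n] (u : n → n → A) : Prop where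
  mul : ∀ a b c d, u a b * u c d = if b = c then u a d else 0
  sum_diag : ∑ a, u a a = 1

/-- The element `∑ M a b • u a b` of a ring with matrix units `u`, i.e. the matrix `M` acting on
the tensor factor that the matrix units describe. -/
def ofUnits (u : n → n → A) : Matrix n n 𝕜 →ₗ[𝕜] A :=
  ∑ a, ∑ b, (Matrix.entryLinearMap 𝕜 𝕜 a b).smulRight (u a b)

lemma ofUnits_apply (u : n → n → A) (M : Matrix n n 𝕜) :
    ofUnits u M = ∑ a, ∑ b, M a b • u a b := by
  simp [ofUnits, LinearMap.sum_apply]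

lemma commute_ofUnits {u : n → n → A} {y : A} (hy : ∀ a b, Commute y (u a b))
    (M : Matrix n n 𝕜) : Commute y (ofUnits u M) := by
  rw [ofUnits_apply]
  exact Commute.sum_right _ _ _ fun _ _ => Commute.sum_right _ _ _ fun _ _ =>
    (hy _ _).smul_right _

variable [DecidableEq n]

lemma ofUnits_single (u : n → n → A) (a b : n) :
    ofUnits u (Matrix.single a b (1 : 𝕜)) = u a b := by
  simp [ofUnits_apply, Matrix.single_apply, ite_and]

namespace IsMatrixUnits

variable {u : n → n → A}

lemma ofUnits_one (hu : IsMatrixUnits u) : ofUnits u (1 : Matrix n n 𝕜) = 1 := by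
  simp [ofUnits_apply, Matrix.one_apply, hu.sum_diag]

lemma ofUnits_mul (hu : IsMatrixUnits u) (M M' : Matrix n n 𝕜) :
    ofUnits u (M * M') = ofUnits u M * ofUnits u M' := by
  simp only [ofUnits_apply, sum_mul_sum, smul_mul_smul_comm, hu.mul, smul_ite, smul_zero,
    Matrix.mul_apply, sum_smul]
  refine sum_congr rfl fun a _ => ?_
  rw [sum_comm]
  refine sum_congr rfl fun c _ => ?_
  rw [sum_comm]
  simp

lemma prod {m : Type*} [Fintype m] [DecidableEq m] (hu : IsMatrixUnits u) {v : m → m → A}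
    (hv : IsMatrixUnits v) (huv : ∀ a b c d, Commute (u a b) (v c d)) :
    IsMatrixUnits fun p r : n × m => u p.1 r.1 * v p.2 r.2 where
  mul p r s t := by
    rw [(huv s.1 t.1 p.2 r.2).symm.mul_mul_mul_comm, hu.mul, hv.mul, ite_zero_mul_ite_zero]
    simp only [Prod.ext_iff]
  sum_diag := by
    rw [Fintype.sum_prod_type]
    simp_rw [← mul_sum, hv.sum_diag, mul_one, hu.sum_diag]

end IsMatrixUnits

/-- A family of systems of matrix units, indexed by the sites `ι`, that commute with each other:
it presents a ring as acting on a tensor product with one factor for each site. -/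
structure IsCommutingMatrixUnits {ι : Type*} (e : ι → n → n → A) : Prop where
  isMatrixUnits : ∀ i, IsMatrixUnits (e i)
  commute : ∀ {i j}, i ≠ j → ∀ a b c d, Commute (e i a b) (e j c d)

end MatrixUnits

section PartialTrace

variable {𝕜 ι n A : Type*} [Fintype n] [CommSemiring 𝕜] [Semiring A] [Algebra 𝕜 A]

/-- The matrix `M` acting at the site `i`. -/
def site (e : ι → n → n → A) (i : ι) : Matrix n n 𝕜 →ₗ[𝕜] A := ofUnits (e i)

/-- The matrix `M` acting at the sites `i` and `j`. -/
def pair (e : ι → n → n → A) (i j : ι) : Matrix (n × n) (n × n) 𝕜 →ₗ[𝕜] A :=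
  ofUnits fun p r => e i p.1 r.1 * e j p.2 r.2

variable (𝕜) in
/-- The matrix entry `(a, b)` of an element with respect to the site `i`; it is an element that
commutes with the matrix units of that site. -/
def entry (e : ι → n → n → A) (i : ι) (a b : n) : A →ₗ[𝕜] A :=
  ∑ c, LinearMap.mulLeftRight 𝕜 (e i c a, e i b c)

variable (𝕜) in
/-- The partial trace over the site `i`. -/
def partialTrace (e : ι → n → n → A) (i : ι) : A →ₗ[𝕜] A :=
  ∑ a, entry 𝕜 e i a a

/-- The partial trace over the site `i` weighted by `C`, i.e. `x ↦ Tr_(i) (C_i x)`. -/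
def weightedTrace (e : ι → n → n → A) (C : Matrix n n 𝕜) (i : ι) : A →ₗ[𝕜] A :=
  partialTrace 𝕜 e i ∘ₗ LinearMap.mulLeft 𝕜 (site e i C)

/-- The weighted partial trace `Tr_(2) (C_2 M)` of a matrix on two tensor factors. -/
def rightTrace (C : Matrix n n 𝕜) : Matrix (n × n) (n × n) 𝕜 →ₗ[𝕜] Matrix n n 𝕜 where
  toFun M := Matrix.of fun a b => ∑ x, ∑ y, C y x * M (a, x) (b, y)
  map_add' M M' := by
    ext a b
    simp [mul_add, sum_add_distrib]
  map_smul' c M := by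
    ext a b
    simp [mul_sum, mul_left_comm]

lemma rightTrace_apply (C : Matrix n n 𝕜) (M : Matrix (n × n) (n × n) 𝕜) (a b : n) :
    rightTrace C M a b = ∑ x, ∑ y, C y x * M (a, x) (b, y) := rfl

variable {e : ι → n → n → A}

lemma entry_apply (i : ι) (a b : n) (x : A) :
    entry 𝕜 e i a b x = ∑ c, e i c a * x * e i b c := by
  simp [entry, LinearMap.sum_apply]

lemma partialTrace_apply (i : ι) (x : A) :
    partialTrace 𝕜 e i x = ∑ a, ∑ c, e i c a * x * e i a c := by
  simp [partialTrace, LinearMap.sum_apply, entry_apply]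

lemma weightedTrace_apply (C : Matrix n n 𝕜) (i : ι) (x : A) :
    weightedTrace e C i x = partialTrace 𝕜 e i (site e i C * x) := rfl

lemma commute_site {y : A} {i : ι} (hy : ∀ a b, Commute y (e i a b)) (M : Matrix n n 𝕜) :
    Commute y (site e i M) :=
  commute_ofUnits hy M

lemma commute_pair {y : A} {i j : ι} (hi : ∀ a b, Commute y (e i a b))
    (hj : ∀ a b, Commute y (e j a b)) (M : Matrix (n × n) (n × n) 𝕜) :
    Commute y (pair e i j M) :=
  commute_ofUnits (fun _ _ => (hi _ _).mul_right (hj _ _)) M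

lemma pair_kronecker (i j : ι) (M M' : Matrix n n 𝕜) :
    pair e i j (M ⊗ₖ M') = site e i M * site e j M' := by
  simp only [pair, site, ofUnits_apply, Matrix.kroneckerMap_apply, Fintype.sum_prod_type,
    sum_mul_sum, smul_mul_smul_comm]

lemma commute_entry {y x : A} {i : ι} (hy : ∀ a b, Commute y (e i a b)) (hx : Commute y x)
    (a b : n) : Commute y (entry 𝕜 e i a b x) := by
  rw [entry_apply]
  exact Commute.sum_right _ _ _ fun _ _ => ((hy _ _).mul_right hx).mul_right (hy _ _)

lemma commute_partialTrace {y x : A} {i : ι} (hy : ∀ a b, Commute y (e i a b))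
    (hx : Commute y x) : Commute y (partialTrace 𝕜 e i x) := by
  rw [partialTrace, LinearMap.sum_apply]
  exact Commute.sum_right _ _ _ fun _ _ => commute_entry hy hx _ _

lemma commute_weightedTrace {y x : A} {i : ι} (hy : ∀ a b, Commute y (e i a b))
    (hx : Commute y x) (C : Matrix n n 𝕜) : Commute y (weightedTrace e C i x) :=
  commute_partialTrace hy ((commute_site hy C).mul_right hx)

lemma partialTrace_mul_of_commute {y : A} {i : ι} (hy : ∀ a b, Commute y (e i a b)) (x : A) :
    partialTrace 𝕜 e i (y * x) = y * partialTrace 𝕜 e i x := by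
  simp only [partialTrace_apply, mul_sum, ← mul_assoc, (hy _ _).eq]

lemma partialTrace_mul_of_commute' {y : A} {i : ι} (hy : ∀ a b, Commute y (e i a b)) (x : A) :
    partialTrace 𝕜 e i (x * y) = partialTrace 𝕜 e i x * y := by
  simp only [partialTrace_apply, sum_mul, mul_assoc, (hy _ _).eq]

lemma weightedTrace_mul_of_commute {y : A} {i : ι} (hy : ∀ a b, Commute y (e i a b))
    (C : Matrix n n 𝕜) (x : A) :
    weightedTrace e C i (y * x) = y * weightedTrace e C i x := by
  rw [weightedTrace_apply, weightedTrace_apply, ← partialTrace_mul_of_commute hy,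
    ← (commute_site hy C).left_comm]

lemma weightedTrace_mul_of_commute' {y : A} {i : ι} (hy : ∀ a b, Commute y (e i a b))
    (C : Matrix n n 𝕜) (x : A) :
    weightedTrace e C i (x * y) = weightedTrace e C i x * y := by
  rw [weightedTrace_apply, weightedTrace_apply, ← partialTrace_mul_of_commute' hy, mul_assoc]

namespace IsCommutingMatrixUnits

variable [DecidableEq n] (he : IsCommutingMatrixUnits e)
include he

lemma mul (i : ι) (a b c d : n) : e i a b * e i c d = if b = c then e i a d else 0 :=
  (he.isMatrixUnits i).mul a b c d

lemma site_one (i : ι) : site e i (1 : Matrix n n 𝕜) = 1 :=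
  (he.isMatrixUnits i).ofUnits_one

lemma isMatrixUnits_pair {i j : ι} (hij : i ≠ j) :
    IsMatrixUnits fun p r : n × n => e i p.1 r.1 * e j p.2 r.2 :=
  (he.isMatrixUnits i).prod (he.isMatrixUnits j) (he.commute hij)

lemma pair_one {i j : ι} (hij : i ≠ j) : pair e i j (1 : Matrix (n × n) (n × n) 𝕜) = 1 :=
  (he.isMatrixUnits_pair hij).ofUnits_one

lemma pair_mul {i j : ι} (hij : i ≠ j) (M M' : Matrix (n × n) (n × n) 𝕜) :
    pair e i j (M * M') = pair e i j M * pair e i j M' :=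
  (he.isMatrixUnits_pair hij).ofUnits_mul M M'

lemma mul_entry (i : ι) (a b s t : n) (x : A) :
    e i s t * entry 𝕜 e i a b x = e i s a * x * e i b t := by
  simp [entry_apply, mul_sum, ← mul_assoc, he.mul, ite_mul]

lemma entry_mul (i : ι) (a b s t : n) (x : A) :
    entry 𝕜 e i a b x * e i s t = e i s a * x * e i b t := by
  simp [entry_apply, sum_mul, mul_assoc, he.mul]

lemma commute_unit_entry (i : ι) (a b s t : n) (x : A) :
    Commute (e i s t) (entry 𝕜 e i a b x) :=
  (he.mul_entry i a b s t x).trans (he.entry_mul i a b s t x).symm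

lemma commute_unit_weightedTrace (i : ι) (s t : n) (C : Matrix n n 𝕜) (x : A) :
    Commute (e i s t) (weightedTrace e C i x) := by
  rw [weightedTrace_apply, partialTrace, LinearMap.sum_apply]
  exact Commute.sum_right _ _ _ fun _ _ => he.commute_unit_entry i _ _ s t _

lemma sum_entry_mul_unit (i : ι) (x : A) : ∑ a, ∑ b, entry 𝕜 e i a b x * e i a b = x := by
  simp only [he.entry_mul, ← mul_sum, ← sum_mul, (he.isMatrixUnits i).sum_diag, one_mul, mul_one]

lemma entry_site (i : ι) (a b : n) (M : Matrix n n 𝕜) :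
    entry 𝕜 e i a b (site e i M) = M a b • 1 := by
  have hsum (c : n) : e i c a * site e i M * e i b c = M a b • e i c c := by
    simp [site, ofUnits_apply, mul_sum, sum_mul, he.mul]
  simp only [entry_apply, hsum, ← smul_sum, (he.isMatrixUnits i).sum_diag]

lemma partialTrace_unit_mul (i : ι) (a b : n) (x : A) :
    partialTrace 𝕜 e i (e i a b * x) = entry 𝕜 e i b a x := by
  rw [partialTrace_apply, sum_comm]
  simp [entry_apply, ← mul_assoc, he.mul, ite_mul]

lemma partialTrace_mul_unit (i : ι) (a b : n) (x : A) :
    partialTrace 𝕜 e i (x * e i a b) = entry 𝕜 e i b a x := by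
  rw [partialTrace_apply, sum_comm]
  simp [entry_apply, mul_assoc, he.mul]

lemma weightedTrace_eq_sum_entry (C : Matrix n n 𝕜) (i : ι) (x : A) :
    weightedTrace e C i x = ∑ a, ∑ b, C a b • entry 𝕜 e i b a x := by
  simp only [weightedTrace_apply, site, ofUnits_apply, sum_mul, smul_mul_assoc, map_sum, map_smul,
    he.partialTrace_unit_mul]

lemma weightedTrace_unit (C : Matrix n n 𝕜) (i : ι) (a b : n) :
    weightedTrace e C i (e i a b) = C b a • 1 := by
  rw [weightedTrace_apply, he.partialTrace_mul_unit, he.entry_site]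

lemma weightedTrace_pair {i j : ι} (hij : i ≠ j) (C : Matrix n n 𝕜)
    (M : Matrix (n × n) (n × n) 𝕜) :
    weightedTrace e C j (pair e i j M) = site e i (rightTrace C M) := by
  have hunit (a x b y : n) :
      weightedTrace e C j (e i a b * e j x y) = C y x • e i a b := by
    rw [weightedTrace_mul_of_commute (he.commute hij a b), he.weightedTrace_unit,
      mul_smul_comm, mul_one]
  simp only [pair, site, ofUnits_apply, map_sum, map_smul, hunit, rightTrace_apply, sum_smul,
    smul_smul, Fintype.sum_prod_type, mul_comm (C _ _)]
  refine sum_congr rfl fun a _ => ?_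
  rw [sum_comm]

lemma partialTrace_partialTrace_pair_mul {i j : ι} (hij : i ≠ j) (M : Matrix (n × n) (n × n) 𝕜)
    (x : A) :
    partialTrace 𝕜 e i (partialTrace 𝕜 e j (pair e i j M * x)) =
      partialTrace 𝕜 e i (partialTrace 𝕜 e j (x * pair e i j M)) := by
  simp only [pair, ofUnits_apply, sum_mul, mul_sum, map_sum, smul_mul_assoc, mul_smul_comm,
    map_smul]
  refine sum_congr rfl fun p _ => sum_congr rfl fun r _ => congrArg _ ?_
  have hcomm := he.commute hij p.1 r.1
  calc partialTrace 𝕜 e i (partialTrace 𝕜 e j (e i p.1 r.1 * e j p.2 r.2 * x))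
      = partialTrace 𝕜 e i (e i p.1 r.1 * entry 𝕜 e j r.2 p.2 x) := by
        rw [mul_assoc, partialTrace_mul_of_commute hcomm, he.partialTrace_unit_mul j]
    _ = partialTrace 𝕜 e i (entry 𝕜 e j r.2 p.2 x * e i p.1 r.1) := by
        rw [he.partialTrace_unit_mul, he.partialTrace_mul_unit]
    _ = partialTrace 𝕜 e i (partialTrace 𝕜 e j (x * (e i p.1 r.1 * e j p.2 r.2))) := by
        rw [(hcomm _ _).eq, ← mul_assoc, partialTrace_mul_of_commute' hcomm,
          he.partialTrace_mul_unit j]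

lemma weightedTrace_weightedTrace {i j : ι} (hij : i ≠ j) (C : Matrix n n 𝕜) (x : A) :
    weightedTrace e C i (weightedTrace e C j x) =
      partialTrace 𝕜 e i (partialTrace 𝕜 e j (pair e i j (C ⊗ₖ C) * x)) := by
  have hcomm (a b : n) : Commute (site e i C) (e j a b) :=
    (commute_site (fun _ _ => he.commute hij.symm a b _ _) C).symm
  rw [weightedTrace_apply, weightedTrace_apply, pair_kronecker, mul_assoc,
    partialTrace_mul_of_commute hcomm]

lemma weightedTrace_weightedTrace_pair_mul {i j : ι} (hij : i ≠ j) {C : Matrix n n 𝕜}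
    {M : Matrix (n × n) (n × n) 𝕜} (hM : Commute (C ⊗ₖ C) M) (x : A) :
    weightedTrace e C i (weightedTrace e C j (pair e i j M * x)) =
      weightedTrace e C i (weightedTrace e C j (x * pair e i j M)) := by
  rw [he.weightedTrace_weightedTrace hij, he.weightedTrace_weightedTrace hij, ← mul_assoc,
    ← mul_assoc, ← he.partialTrace_partialTrace_pair_mul hij, ← mul_assoc, ← he.pair_mul hij,
    ← he.pair_mul hij, hM.eq]

lemma weightedTrace_pair_mul_mul_pair {i j : ι} (hij : i ≠ j) {C : Matrix n n 𝕜}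
    {M M' : Matrix (n × n) (n × n) 𝕜}
    (hM : ∀ X, rightTrace C (M * (X ⊗ₖ 1) * M') = (C * X).trace • 1)
    {x : A} (hx : ∀ a b, Commute x (e j a b)) :
    weightedTrace e C j (pair e i j M * x * pair e i j M') = weightedTrace e C i x := by
  have hunit (a b : n) :
      weightedTrace e C j (pair e i j M * e i a b * pair e i j M') = C b a • 1 := by
    have hpair : e i a b = pair e i j (Matrix.single a b (1 : 𝕜) ⊗ₖ 1) := by
      rw [pair_kronecker, he.site_one, mul_one, site, ofUnits_single]
    rw [hpair, ← he.pair_mul hij, ← he.pair_mul hij, he.weightedTrace_pair hij, hM,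
      map_smul, he.site_one, Matrix.trace_mul_single, MulOpposite.op_one, one_smul]
  have hentry_i (a b s t : n) : Commute (entry 𝕜 e i a b x) (e i s t) :=
    (he.commute_unit_entry i a b s t x).symm
  have hentry_j (a b s t : n) : Commute (entry 𝕜 e i a b x) (e j s t) :=
    (commute_entry (fun _ _ => he.commute hij.symm s t _ _) (hx s t).symm a b).symm
  have hterm (a b : n) :
      weightedTrace e C j (pair e i j M * (entry 𝕜 e i a b x * e i a b) * pair e i j M') =
        C b a • entry 𝕜 e i a b x := by
    rw [(commute_pair (hentry_i a b) (hentry_j a b) M).symm.left_comm,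
      mul_assoc (entry 𝕜 e i a b x), weightedTrace_mul_of_commute (hentry_j a b), hunit,
      mul_smul_comm, mul_one]
  conv_lhs => rw [← he.sum_entry_mul_unit (𝕜 := 𝕜) i x]
  simp only [mul_sum, sum_mul, map_sum, hterm]
  rw [sum_comm, he.weightedTrace_eq_sum_entry]

end IsCommutingMatrixUnits

end PartialTrace

/-! ### The trace matrix of a skew-invertible braid operator -/

section TwoSite

variable {S : Type*} [Semiring S] {N n : ℕ}

lemma sum_twoSite_mul (i : Fin n) (M : Matrix (Fin N × Fin N) (Fin N × Fin N) S)
    (v : Fin (n + 1) → Fin N) (g : (Fin (n + 1) → Fin N) → S) :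
    ∑ w, twoSite i M v w * g w = ∑ p : Fin N × Fin N, M (v i.castSucc, v i.succ) p *
      g (Function.update (Function.update v i.castSucc p.1) i.succ p.2) := by
  have hne : i.castSucc ≠ i.succ := Fin.castSucc_lt_succ.ne
  refine (Fintype.sum_of_injective
    (fun p : Fin N × Fin N => Function.update (Function.update v i.castSucc p.1) i.succ p.2)
    (fun p r h => ?_) _ _ (fun w hw => ?_) fun p => ?_).symm
  · simpa [hne, Prod.ext_iff] using And.intro (congrFun h i.castSucc) (congrFun h i.succ)
  · suffices ¬ ∀ k, k ≠ i.castSucc → k ≠ i.succ → v k = w k by simp [twoSite, this]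
    refine fun h => hw ⟨(w i.castSucc, w i.succ), funext fun k => ?_⟩
    grind [Function.update_apply]
  · have hfix : ∀ k, k ≠ i.castSucc → k ≠ i.succ →
        v k = Function.update (Function.update v i.castSucc p.1) i.succ p.2 k :=
      fun k h₁ h₂ => by simp [h₁, h₂]
    rw [twoSite, Matrix.of_apply, if_pos hfix]
    simp [hne]

lemma twoSite_update_update (i : Fin n) (M : Matrix (Fin N × Fin N) (Fin N × Fin N) S)
    (v w : Fin (n + 1) → Fin N) (p : Fin N × Fin N) :
    twoSite i M (Function.update (Function.update v i.castSucc p.1) i.succ p.2) w =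
      if ∀ k, k ≠ i.castSucc → k ≠ i.succ → v k = w k then M p (w i.castSucc, w i.succ) else 0 := by
  have hne : i.castSucc ≠ i.succ := Fin.castSucc_lt_succ.ne
  have hfix : (∀ k, k ≠ i.castSucc → k ≠ i.succ →
      Function.update (Function.update v i.castSucc p.1) i.succ p.2 k = w k) ↔
      ∀ k, k ≠ i.castSucc → k ≠ i.succ → v k = w k :=
    forall₃_congr fun k h₁ h₂ => by simp [h₁, h₂]
  simp [twoSite, hfix, hne]

lemma twoSite_mul (i : Fin n) (M M' : Matrix (Fin N × Fin N) (Fin N × Fin N) S) :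
    twoSite i (M * M') = twoSite i M * twoSite i M' := by
  ext v w
  rw [Matrix.mul_apply, sum_twoSite_mul]
  simp only [twoSite_update_update, mul_ite, mul_zero]
  simp only [twoSite, Matrix.of_apply, Matrix.mul_apply]
  split_ifs <;> simp

lemma twoSite_one (i : Fin n) :
    twoSite i (1 : Matrix (Fin N × Fin N) (Fin N × Fin N) S) = 1 := by
  ext v w
  simp only [twoSite, Matrix.of_apply, Matrix.one_apply, Prod.mk.injEq, ← ite_and]
  congr 1
  refine propext ⟨fun h => funext fun k => ?_, fun h => by simp [h]⟩
  grind

end TwoSite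

section Reshuffle

variable {n 𝕜 : Type*}

/-- The matrix `M` on two tensor factors regarded as a matrix from the second factor to the first.
The order of the indices is such that skew-inversion becomes inversion of matrices. -/
def reshuffle (M : Matrix (n × n) (n × n) 𝕜) : Matrix (n × n) (n × n) 𝕜 :=
  Matrix.of fun p r => M (p.1, r.2) (p.2, r.1)

variable [Fintype n] [CommSemiring 𝕜]

lemma rightTrace_apply_eq_mulVec (C : Matrix n n 𝕜) (M : Matrix (n × n) (n × n) 𝕜) (a b : n) :
    rightTrace C M a b = (reshuffle M *ᵥ fun p => C p.1 p.2) (a, b) := by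
  simp only [rightTrace_apply, Matrix.mulVec, dotProduct, reshuffle, Matrix.of_apply,
    Fintype.sum_prod_type, mul_comm (C _ _)]
  exact sum_comm

end Reshuffle

section Skew

variable {N : ℕ} {R Ψ : Matrix (Fin N × Fin N) (Fin N × Fin N) ℂ}

lemma IsSkewInverse.reshuffle_mul_reshuffle (hΨ : IsSkewInverse R Ψ) :
    reshuffle Ψ * reshuffle R = 1 := by
  ext ⟨b, a⟩ ⟨d, c⟩
  rw [Matrix.mul_apply, Fintype.sum_prod_type, sum_comm]
  simpa [Matrix.one_apply, reshuffle, eq_comm (a := c)] using hΨ.right b c a d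

lemma rightTrace_traceMatrix (hΨ : IsSkewInverse R Ψ) : rightTrace (traceMatrix Ψ) R = 1 := by
  have htrace : (fun p : Fin N × Fin N => traceMatrix Ψ p.1 p.2) =
      reshuffle Ψ *ᵥ fun p => (1 : Matrix (Fin N) (Fin N) ℂ) p.1 p.2 := by
    ext ⟨i, j⟩
    simp [traceMatrix, Matrix.mulVec, dotProduct, reshuffle, Fintype.sum_prod_type,
      Matrix.one_apply]
  ext a b
  rw [rightTrace_apply_eq_mulVec, htrace, Matrix.mulVec_mulVec,
    mul_eq_one_comm.mp hΨ.reshuffle_mul_reshuffle, Matrix.one_mulVec]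

section ThreeFactors

variable (M M' M'' : Matrix (Fin N × Fin N) (Fin N × Fin N) ℂ) (u s x w t y : Fin N)

lemma twoSite_one_zero_one_apply :
    (twoSite (1 : Fin 2) M * (twoSite (0 : Fin 2) M' * twoSite (1 : Fin 2) M''))
        ![u, s, x] ![w, t, y] =
      (M * (M'.submatrix (Prod.mk u) (Prod.mk w) ⊗ₖ (1 : Matrix (Fin N) (Fin N) ℂ) * M''))
        (s, x) (t, y) := by
  have hupdate₁ (c p : Fin N) :
      Function.update (Function.update ![u, s, x] (1 : Fin 3) c) 2 p = ![u, c, p] := by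
    funext k; fin_cases k <;> simp
  have hupdate₀ (c p b d : Fin N) :
      Function.update (Function.update ![u, c, p] (0 : Fin 3) b) 1 d = ![b, d, p] := by
    funext k; fin_cases k <;> simp
  have htwoSite (b d p : Fin N) : twoSite (1 : Fin 2) M'' ![b, d, p] ![w, t, y] =
      if b = w then M'' (d, p) (t, y) else 0 := by
    simp [twoSite, Fin.forall_fin_succ]
    rfl
  rw [Matrix.mul_apply, sum_twoSite_mul, Matrix.mul_apply]
  refine sum_congr rfl fun p _ => congrArg (M (s, x) p * ·) ?_
  simp only [Fin.isValue, Fin.castSucc_one, Fin.succ_one_eq_two, hupdate₁]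
  rw [Matrix.mul_apply, sum_twoSite_mul, Matrix.mul_apply]
  simp [hupdate₀, htwoSite, Fintype.sum_prod_type, Matrix.one_apply]

lemma twoSite_zero_one_zero_apply :
    (twoSite (0 : Fin 2) M * (twoSite (1 : Fin 2) M' * twoSite (0 : Fin 2) M''))
        ![u, s, x] ![w, t, y] =
      (M * ((1 : Matrix (Fin N) (Fin N) ℂ) ⊗ₖ M'.submatrix (·, x) (·, y) * M'')) (u, s) (w, t) := by
  have hupdate₀ (c p : Fin N) :
      Function.update (Function.update ![u, s, x] (0 : Fin 3) c) 1 p = ![c, p, x] := by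
    funext k; fin_cases k <;> simp
  have hupdate₁ (c p b d : Fin N) :
      Function.update (Function.update ![c, p, x] (1 : Fin 3) b) 2 d = ![c, b, d] := by
    funext k; fin_cases k <;> simp
  have htwoSite (c b d : Fin N) : twoSite (0 : Fin 2) M'' ![c, b, d] ![w, t, y] =
      if d = y then M'' (c, b) (w, t) else 0 := by
    simp [twoSite, Fin.forall_fin_succ]
    rfl
  rw [Matrix.mul_apply, sum_twoSite_mul, Matrix.mul_apply]
  refine sum_congr rfl fun p _ => congrArg (M (u, s) p * ·) ?_
  simp only [Fin.isValue, Fin.castSucc_zero, Fin.succ_zero_eq_one, hupdate₀]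
  rw [Matrix.mul_apply, sum_twoSite_mul, Matrix.mul_apply]
  simp [hupdate₁, htwoSite, Fintype.sum_prod_type, Matrix.one_apply]

end ThreeFactors

lemma rightTrace_mul_block_kronecker_one_mul (hΨ : IsSkewInverse R Ψ)
    {A B : Matrix (Fin N × Fin N) (Fin N × Fin N) ℂ} (hBA : B * A = 1)
    (hAB : twoSite (1 : Fin 2) A * (twoSite (0 : Fin 2) R * twoSite (1 : Fin 2) B) =
      twoSite (0 : Fin 2) B * (twoSite (1 : Fin 2) R * twoSite (0 : Fin 2) A)) (u w : Fin N) :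
    rightTrace (traceMatrix Ψ) (A * (R.submatrix (Prod.mk u) (Prod.mk w) ⊗ₖ 1) * B) =
      (1 : Matrix (Fin N) (Fin N) ℂ) u w • 1 := by
  set C := traceMatrix Ψ
  let conj : Matrix (Fin N) (Fin N) ℂ →ₗ[ℂ] Matrix (Fin N × Fin N) (Fin N × Fin N) ℂ :=
    LinearMap.mulLeft ℂ B ∘ₗ LinearMap.mulRight ℂ A ∘ₗ
      Matrix.kroneckerMapBilinear (LinearMap.mul ℂ ℂ) 1
  have htrace : ∑ x, ∑ y, C y x • R.submatrix (·, x) (·, y) = 1 := by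
    rw [← rightTrace_traceMatrix hΨ]
    ext f g
    simp [rightTrace_apply, Matrix.sum_apply, C]
  ext s t
  calc rightTrace C (A * (R.submatrix (Prod.mk u) (Prod.mk w) ⊗ₖ 1) * B) s t
      = ∑ x, ∑ y, C y x * conj (R.submatrix (·, x) (·, y)) (u, s) (w, t) := by
        simp only [rightTrace_apply, mul_assoc]
        simp only [← twoSite_one_zero_one_apply, hAB, twoSite_zero_one_zero_apply]
        rfl
    _ = conj (∑ x, ∑ y, C y x • R.submatrix (·, x) (·, y)) (u, s) (w, t) := by
        simp [Matrix.sum_apply]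
    _ = (1 : Matrix (Fin N × Fin N) (Fin N × Fin N) ℂ) (u, s) (w, t) := by
        rw [htrace]
        simp [conj, hBA]
    _ = ((1 : Matrix (Fin N) (Fin N) ℂ) u w • (1 : Matrix (Fin N) (Fin N) ℂ)) s t := by
        rw [← Matrix.one_kronecker_one]
        rfl

lemma IsSkewInverse.span_range_block (hΨ : IsSkewInverse R Ψ) :
    Submodule.span ℂ (Set.range fun p : Fin N × Fin N =>
      R.submatrix (Prod.mk p.1) (Prod.mk p.2)) = ⊤ := by
  refine Submodule.eq_top_iff'.mpr fun X => ?_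
  set c := (fun p : Fin N × Fin N => X p.2 p.1) ᵥ* reshuffle Ψ with hc
  have hX : c ᵥ* reshuffle R = fun p => X p.2 p.1 := by
    rw [hc, Matrix.vecMul_vecMul, hΨ.reshuffle_mul_reshuffle, Matrix.vecMul_one]
  have hsum : X = ∑ p, c p • R.submatrix (Prod.mk p.1) (Prod.mk p.2) := by
    ext a b
    simpa [Matrix.vecMul, dotProduct, reshuffle, Matrix.sum_apply] using
      (congrFun hX (b, a)).symm
  rw [hsum]
  exact Submodule.sum_mem _ fun p _ =>
    Submodule.smul_mem _ _ (Submodule.subset_span (Set.mem_range_self p))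

lemma rightTrace_mul_kronecker_one_mul (hΨ : IsSkewInverse R Ψ)
    {A B : Matrix (Fin N × Fin N) (Fin N × Fin N) ℂ} (hBA : B * A = 1)
    (hAB : twoSite (1 : Fin 2) A * (twoSite (0 : Fin 2) R * twoSite (1 : Fin 2) B) =
      twoSite (0 : Fin 2) B * (twoSite (1 : Fin 2) R * twoSite (0 : Fin 2) A))
    (X : Matrix (Fin N) (Fin N) ℂ) :
    rightTrace (traceMatrix Ψ) (A * (X ⊗ₖ 1) * B) = (traceMatrix Ψ * X).trace • 1 := by
  set C := traceMatrix Ψ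
  have hmaps : rightTrace C ∘ₗ LinearMap.mulLeftRight ℂ (A, B) ∘ₗ
        (Matrix.kroneckerMapBilinear (LinearMap.mul ℂ ℂ)).flip 1 =
      (Matrix.traceLinearMap (Fin N) ℂ ℂ ∘ₗ LinearMap.mulLeft ℂ C).smulRight 1 := by
    refine LinearMap.ext_on_range hΨ.span_range_block fun ⟨u, w⟩ => ?_
    have htrace : (C * R.submatrix (Prod.mk u) (Prod.mk w)).trace =
        (1 : Matrix (Fin N) (Fin N) ℂ) u w := by
      rw [← rightTrace_traceMatrix hΨ, rightTrace_apply, sum_comm]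
      simp [Matrix.trace, Matrix.mul_apply, C]
    simpa [htrace] using rightTrace_mul_block_kronecker_one_mul hΨ hBA hAB u w
  simpa using LinearMap.congr_fun hmaps X

section SwapSkewInverse

variable {C : Matrix (Fin N) (Fin N) ℂ}

lemma rightTrace_mul_single_kronecker_one_mul_apply (C : Matrix (Fin N) (Fin N) ℂ)
    (A B : Matrix (Fin N × Fin N) (Fin N × Fin N) ℂ) (a b s t : Fin N) :
    rightTrace C (A * (Matrix.single a b 1 ⊗ₖ 1) * B) s t =
      ∑ x, ∑ y, C y x * ∑ p, A (s, x) (a, p) * B (b, p) (t, y) := by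
  simp [rightTrace_apply, Matrix.mul_apply, Fintype.sum_prod_type, Matrix.single_apply,
    Matrix.one_apply, ite_and]

lemma IsSkewInverse.mul_one_kronecker (hΨ : IsSkewInverse R Ψ)
    {B : Matrix (Fin N × Fin N) (Fin N × Fin N) ℂ}
    (hB : ∀ X, rightTrace C (R * (X ⊗ₖ 1) * B) = (C * X).trace • 1) :
    B * (1 ⊗ₖ C) = (C ⊗ₖ 1) * Ψ.submatrix Prod.swap Prod.swap := by
  ext ⟨b, p⟩ ⟨t, x⟩
  have hvec : reshuffle R *ᵥ (fun r => ∑ y, B (b, r.1) (t, y) * C y r.2) =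
      fun r => if r.1 = t then C b r.2 else 0 := by
    ext ⟨s, a⟩
    calc (reshuffle R *ᵥ fun r => ∑ y, B (b, r.1) (t, y) * C y r.2) (s, a)
        = ∑ x, ∑ y, C y x * ∑ p, R (s, x) (a, p) * B (b, p) (t, y) := by
          simp only [Matrix.mulVec, dotProduct, reshuffle, Matrix.of_apply,
            Fintype.sum_prod_type_right, mul_sum]
          refine sum_congr rfl fun x _ => sum_comm.trans ?_
          simp only [mul_comm (C _ _), mul_assoc]
      _ = if s = t then C b a else 0 := by
          rw [← rightTrace_mul_single_kronecker_one_mul_apply, hB]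
          simp [Matrix.one_apply, Matrix.trace_mul_single]
  have hsolve := congrArg (reshuffle Ψ *ᵥ ·) hvec
  simp only [Matrix.mulVec_mulVec, hΨ.reshuffle_mul_reshuffle, Matrix.one_mulVec] at hsolve
  simpa [Matrix.mulVec, dotProduct, reshuffle, Matrix.mul_apply, Fintype.sum_prod_type,
    Matrix.one_apply, mul_comm] using congrFun hsolve (p, x)

lemma IsSkewInverse.one_kronecker_mul (hΨ : IsSkewInverse R Ψ)
    {A : Matrix (Fin N × Fin N) (Fin N × Fin N) ℂ}
    (hA : ∀ X, rightTrace C (A * (X ⊗ₖ 1) * R) = (C * X).trace • 1) :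
    (1 ⊗ₖ C) * A = Ψ.submatrix Prod.swap Prod.swap * (C ⊗ₖ 1) := by
  ext ⟨s, y⟩ ⟨a, p⟩
  have hvec : reshuffle R *ᵥ (fun r => ∑ x, C r.1 x * A (s, x) (a, r.2)) =
      fun r => if r.2 = s then C r.1 a else 0 := by
    ext ⟨b, t⟩
    calc (reshuffle R *ᵥ fun r => ∑ x, C r.1 x * A (s, x) (a, r.2)) (b, t)
        = ∑ x, ∑ y, C y x * ∑ p, A (s, x) (a, p) * R (b, p) (t, y) := by
          simp only [Matrix.mulVec, dotProduct, reshuffle, Matrix.of_apply,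
            Fintype.sum_prod_type, mul_sum]
          refine (sum_congr rfl fun y _ => sum_comm).trans (sum_comm.trans ?_)
          simp only [mul_comm (R _ _), mul_assoc]
      _ = if t = s then C b a else 0 := by
          rw [← rightTrace_mul_single_kronecker_one_mul_apply, hA]
          simp [Matrix.one_apply, Matrix.trace_mul_single, eq_comm]
  have hsolve := congrArg (reshuffle Ψ *ᵥ ·) hvec
  simp only [Matrix.mulVec_mulVec, hΨ.reshuffle_mul_reshuffle, Matrix.one_mulVec] at hsolve
  simpa [Matrix.mulVec, dotProduct, reshuffle, Matrix.mul_apply, Fintype.sum_prod_type,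
    Matrix.one_apply] using congrFun hsolve (y, p)

lemma IsSkewInverse.commute_kronecker (hΨ : IsSkewInverse R Ψ)
    {M : Matrix (Fin N × Fin N) (Fin N × Fin N) ℂ}
    (hRM : ∀ X, rightTrace C (R * (X ⊗ₖ 1) * M) = (C * X).trace • 1)
    (hMR : ∀ X, rightTrace C (M * (X ⊗ₖ 1) * R) = (C * X).trace • 1) :
    Commute (C ⊗ₖ C) M := by
  have hleft : C ⊗ₖ C = (C ⊗ₖ 1) * (1 ⊗ₖ C) := by
    rw [← Matrix.mul_kronecker_mul, mul_one, one_mul]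
  have hright : C ⊗ₖ C = (1 ⊗ₖ C) * (C ⊗ₖ 1) := by
    rw [← Matrix.mul_kronecker_mul, mul_one, one_mul]
  calc C ⊗ₖ C * M = (C ⊗ₖ 1) * ((1 ⊗ₖ C) * M) := by rw [hleft, mul_assoc]
    _ = (C ⊗ₖ 1) * Ψ.submatrix Prod.swap Prod.swap * (C ⊗ₖ 1) := by
        rw [hΨ.one_kronecker_mul hMR, mul_assoc]
    _ = M * (C ⊗ₖ C) := by rw [← hΨ.mul_one_kronecker hRM, hright, mul_assoc]

end SwapSkewInverse

end Skew

namespace IsHeckeSymmetry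

variable {N : ℕ} {q : ℂ} {R Ψ : Matrix (Fin N × Fin N) (Fin N × Fin N) ℂ}

lemma mul_self (hq0 : q ≠ 0) (hR : IsHeckeSymmetry q R) : R * R = (q - q⁻¹) • R + 1 := by
  have hhecke := hR.hecke
  simp only [sub_mul, mul_add, smul_mul_assoc, one_mul, mul_smul_comm, mul_one, smul_sub,
    smul_smul, inv_mul_cancel₀ hq0, one_smul] at hhecke
  rw [sub_smul, ← sub_eq_zero, ← neg_eq_zero, ← hhecke]
  abel

lemma mul_sub (hq0 : q ≠ 0) (hR : IsHeckeSymmetry q R) : R * (R - (q - q⁻¹) • 1) = 1 := by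
  rw [Matrix.mul_sub, hR.mul_self hq0]
  simp

lemma inv_eq (hq0 : q ≠ 0) (hR : IsHeckeSymmetry q R) : R⁻¹ = R - (q - q⁻¹) • 1 :=
  Matrix.inv_eq_right_inv (hR.mul_sub hq0)

lemma mul_inv (hq0 : q ≠ 0) (hR : IsHeckeSymmetry q R) : R * R⁻¹ = 1 := by
  rw [hR.inv_eq hq0, hR.mul_sub hq0]

lemma inv_mul (hq0 : q ≠ 0) (hR : IsHeckeSymmetry q R) : R⁻¹ * R = 1 :=
  mul_eq_one_comm.mp (hR.mul_inv hq0)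

lemma rightTrace_mul_mul_inv (hq0 : q ≠ 0) (hR : IsHeckeSymmetry q R) (hΨ : IsSkewInverse R Ψ)
    (X : Matrix (Fin N) (Fin N) ℂ) :
    rightTrace (traceMatrix Ψ) (R * (X ⊗ₖ 1) * R⁻¹) = (traceMatrix Ψ * X).trace • 1 := by
  refine rightTrace_mul_kronecker_one_mul hΨ (hR.inv_mul hq0) ?_ X
  set R₁ := twoSite (0 : Fin 2) R
  set R₂ := twoSite (1 : Fin 2) R
  have hinv₁ : twoSite (0 : Fin 2) R⁻¹ * R₁ = 1 := by
    rw [← twoSite_mul, hR.inv_mul hq0, twoSite_one]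
  have hinv₂ : R₂ * twoSite (1 : Fin 2) R⁻¹ = 1 := by
    rw [← twoSite_mul, hR.mul_inv hq0, twoSite_one]
  calc R₂ * (R₁ * twoSite (1 : Fin 2) R⁻¹)
      = twoSite (0 : Fin 2) R⁻¹ * R₁ * (R₂ * R₁ * twoSite (1 : Fin 2) R⁻¹) := by
        rw [hinv₁, one_mul, mul_assoc]
    _ = twoSite (0 : Fin 2) R⁻¹ * (R₁ * R₂ * R₁) * twoSite (1 : Fin 2) R⁻¹ := by
        simp only [mul_assoc]
    _ = twoSite (0 : Fin 2) R⁻¹ * (R₂ * R₁) * (R₂ * twoSite (1 : Fin 2) R⁻¹) := by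
        rw [hR.braid]
        simp only [R₁, R₂, mul_assoc]
    _ = twoSite (0 : Fin 2) R⁻¹ * (R₂ * R₁) := by rw [hinv₂, mul_one]

lemma rightTrace_inv_mul_mul (hq0 : q ≠ 0) (hR : IsHeckeSymmetry q R) (hΨ : IsSkewInverse R Ψ)
    (X : Matrix (Fin N) (Fin N) ℂ) :
    rightTrace (traceMatrix Ψ) (R⁻¹ * (X ⊗ₖ 1) * R) = (traceMatrix Ψ * X).trace • 1 := by
  refine rightTrace_mul_kronecker_one_mul hΨ (hR.mul_inv hq0) ?_ X
  set R₁ := twoSite (0 : Fin 2) R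
  set R₂ := twoSite (1 : Fin 2) R
  have hinv₁ : R₁ * twoSite (0 : Fin 2) R⁻¹ = 1 := by
    rw [← twoSite_mul, hR.mul_inv hq0, twoSite_one]
  have hinv₂ : twoSite (1 : Fin 2) R⁻¹ * R₂ = 1 := by
    rw [← twoSite_mul, hR.inv_mul hq0, twoSite_one]
  calc twoSite (1 : Fin 2) R⁻¹ * (R₁ * R₂)
      = twoSite (1 : Fin 2) R⁻¹ * (R₁ * R₂ * R₁) * twoSite (0 : Fin 2) R⁻¹ := by
        simp only [mul_assoc, hinv₁, mul_one]
    _ = twoSite (1 : Fin 2) R⁻¹ * R₂ * (R₁ * (R₂ * twoSite (0 : Fin 2) R⁻¹)) := by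
        rw [hR.braid]
        simp only [R₁, R₂, mul_assoc]
    _ = R₁ * (R₂ * twoSite (0 : Fin 2) R⁻¹) := by rw [hinv₂, one_mul]

lemma commute_traceMatrix_kronecker (hq0 : q ≠ 0) (hR : IsHeckeSymmetry q R)
    (hΨ : IsSkewInverse R Ψ) : Commute (traceMatrix Ψ ⊗ₖ traceMatrix Ψ) R := by
  have hcomm := hΨ.commute_kronecker (hR.rightTrace_mul_mul_inv hq0 hΨ)
    (hR.rightTrace_inv_mul_mul hq0 hΨ)
  rw [hR.inv_eq hq0] at hcomm
  simpa using hcomm.add_right ((Commute.one_right _).smul_right (q - q⁻¹))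

end IsHeckeSymmetry

/-! ### Quantum integers -/

section QNum

variable {q : ℂ}

lemma sub_inv_ne_zero (hq0 : q ≠ 0) (hq : ∀ k : ℕ, 1 ≤ k → q ^ k ≠ 1) : q - q⁻¹ ≠ 0 := by
  intro h
  refine hq 2 one_le_two ?_
  rw [pow_two]
  nth_rw 2 [sub_eq_zero.mp h]
  exact mul_inv_cancel₀ hq0

lemma qNum_ne_zero (hq0 : q ≠ 0) (hq : ∀ k : ℕ, 1 ≤ k → q ^ k ≠ 1) {k : ℕ} (hk : 1 ≤ k) :
    qNum q k ≠ 0 := by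
  refine div_ne_zero (fun h => hq (k + k) (by lia) ?_) (sub_inv_ne_zero hq0 hq)
  rw [pow_add]
  nth_rw 2 [sub_eq_zero.mp h]
  rw [← mul_pow, mul_inv_cancel₀ hq0, one_pow]

lemma mul_qNum (h : q - q⁻¹ ≠ 0) (k : ℕ) : (q - q⁻¹) * qNum q k = q ^ k - q⁻¹ ^ k :=
  mul_div_cancel₀ _ h

lemma qNum_one (h : q - q⁻¹ ≠ 0) : qNum q 1 = 1 := by
  simp [qNum, div_self h]

lemma qNum_succ (hq0 : q ≠ 0) (h : q - q⁻¹ ≠ 0) (k : ℕ) :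
    qNum q (k + 1) = q ^ k + q⁻¹ * qNum q k := by
  apply mul_left_cancel₀ h
  rw [mul_add, mul_left_comm, mul_qNum h, mul_qNum h]
  linear_combination (-q ^ k) * mul_inv_cancel₀ hq0 + q ^ k * mul_inv_cancel₀ hq0

end QNum

/-! ### Braid generators and the copies of `L` -/

section Braid

/-- The product `t_{s+n-1} ⋯ t_s`. -/
def descProd {G : Type*} [Monoid G] (t : ℕ → G) (s : ℕ) : ℕ → G
  | 0 => 1
  | n + 1 => t (s + n) * descProd t s n

/-- The product `t_s ⋯ t_{s+n-1}`. -/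
def ascProd {G : Type*} [Monoid G] (t : ℕ → G) (s : ℕ) : ℕ → G
  | 0 => 1
  | n + 1 => ascProd t s n * t (s + n)

lemma prod_reverse_ofFn {G : Type*} [Monoid G] (t : ℕ → G) (n : ℕ) :
    (List.ofFn fun i : Fin n => t i).reverse.prod = descProd t 0 n := by
  induction n with
  | zero => rfl
  | succ n ih =>
    rw [List.ofFn_succ', List.concat_eq_append, List.reverse_append, List.prod_append, descProd,
      ← ih, zero_add]
    simp

lemma val_descProd {M : Type*} [Monoid M] (t : ℕ → Mˣ) (s n : ℕ) :
    (↑(descProd t s n) : M) = descProd (fun k => (t k : M)) s n := by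
  induction n with
  | zero => rfl
  | succ n ih => simp [descProd, ih]

lemma descProd_succ' {G : Type*} [Monoid G] (t : ℕ → G) (s n : ℕ) :
    descProd t s (n + 1) = descProd t (s + 1) n * t s := by
  induction n with
  | zero => simp [descProd]
  | succ n ih => rw [descProd, ih, descProd, mul_assoc, add_right_comm s 1 n, add_assoc s n 1]

/-- The Artin relations between `r 0, r 1, …`, which thus generate an image of the braid group on
infinitely many strands. -/
structure IsBraidRep {G : Type*} [Mul G] (r : ℕ → G) : Prop where
  braid : ∀ i, r i * r (i + 1) * r i = r (i + 1) * r i * r (i + 1)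
  commute : ∀ {i j}, i + 2 ≤ j → Commute (r j) (r i)

namespace IsBraidRep

lemma semiconj_ascProd {G : Type*} [Monoid G] {r : ℕ → G} (h : IsBraidRep r) (s : ℕ) {n i : ℕ}
    (hi : i + 1 < n) : SemiconjBy (ascProd r s n) (r (s + i)) (r (s + 1 + i)) := by
  have hi' := hi
  induction n, hi' using Nat.le_induction with
  | base =>
    have hb : SemiconjBy (r (s + i) * r (s + i + 1)) (r (s + i)) (r (s + i + 1)) := by
      rw [SemiconjBy, h.braid, mul_assoc]
    have hc : ∀ m ≤ i, Commute (ascProd r s m) (r (s + i + 1)) := by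
      intro m
      induction m with
      | zero => exact fun _ => Commute.one_left _
      | succ m ih => exact fun hm => (ih (by lia)).mul_left (h.commute (by lia)).symm
    rw [add_right_comm s 1 i, ascProd, ascProd, mul_assoc]
    exact SemiconjBy.mul_left (hc i le_rfl) hb
  | succ n hn ih => exact (ih hn).mul_left (h.commute (by lia))

lemma semiconj_descProd {G : Type*} [Group G] {r : ℕ → G} (h : IsBraidRep r) (z : ℤ) (s : ℕ)
    {n m : ℕ} (hm : m < n) :
    SemiconjBy (ascProd r s n) (descProd (r ^ z) s m) (descProd (r ^ z) (s + 1) m) := by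
  induction m with
  | zero => exact SemiconjBy.one_right _
  | succ m ih => exact ((h.semiconj_ascProd s hm).zpow_right z).mul_right (ih (by lia))

end IsBraidRep

variable {M : Type*} [Monoid M]

/-- The matrices `L̄_k`, defined by `L̄_{k+1} = R_k L̄_k R_k⁻¹`; factors are numbered from `0`. -/
def copyL (r : ℕ → Mˣ) (l : M) : ℕ → M
  | 0 => l
  | k + 1 => r k * copyL r l k * ↑(r k)⁻¹

/-- The product `L̄_s ⋯ L̄_{s+j-1}`. -/
def prodL (r : ℕ → Mˣ) (l : M) (s : ℕ) : ℕ → M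
  | 0 => 1
  | j + 1 => prodL r l s j * copyL r l (s + j)

lemma prod_ofFn_copyL (r : ℕ → Mˣ) (l : M) (n : ℕ) :
    (List.ofFn fun i : Fin n => copyL r l i).prod = prodL r l 0 n := by
  induction n with
  | zero => rfl
  | succ n ih =>
    rw [List.ofFn_succ', List.concat_eq_append, List.prod_append, prodL, ← ih, zero_add]
    simp

lemma prodL_add (r : ℕ → Mˣ) (l : M) (i j : ℕ) :
    prodL r l 0 (i + j) = prodL r l 0 i * prodL r l i j := by
  induction j with
  | zero => simp [prodL]
  | succ j ih => simp [← add_assoc, prodL, ih, mul_assoc]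

lemma semiconj_copyL (r : ℕ → Mˣ) (l : M) (k : ℕ) :
    SemiconjBy (r k : M) (copyL r l k) (copyL r l (k + 1)) := by
  simp [SemiconjBy, copyL, mul_assoc]

/-- Braid generators together with a solution `l` of the reflection equation: an image of the
Artin monoid of type `B`, in which the braid generators are invertible. -/
structure IsReflectionRep (r : ℕ → Mˣ) (l : M) : Prop extends IsBraidRep r where
  commute_l : ∀ k, Commute (r (k + 1) : M) l
  reflection : r 0 * l * r 0 * l = l * r 0 * l * r 0

namespace IsReflectionRep

variable {r : ℕ → Mˣ} {l : M} (h : IsReflectionRep r l)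
include h

lemma commute_copyL_of_lt {s j : ℕ} (hj : j < s) : Commute (r s : M) (copyL r l j) := by
  induction j with
  | zero =>
    obtain ⟨s, rfl⟩ := Nat.exists_eq_add_one.mpr hj
    exact h.commute_l s
  | succ j ih =>
    have hr : Commute (r s : M) (r j) := (h.commute hj).units_val
    exact (hr.mul_right (ih (by lia))).mul_right hr.units_inv_right

lemma semiconj_mul_copyL (s : ℕ) :
    SemiconjBy (↑(r s * r (s + 1)) : M) (copyL r l s) (copyL r l (s + 1)) := by
  rw [Units.val_mul]
  exact (semiconj_copyL r l s).mul_left (h.commute_copyL_of_lt s.lt_succ_self)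

/-- Both `L̄_{s+3} = u L̄_{s+1} u⁻¹` and `R_{s+1} = u R_{s+2} u⁻¹` for `u = R_{s+2} R_{s+1}`, while
`R_{s+2}` commutes with `L̄_{s+1}`. -/
lemma commute_copyL_add_two (s : ℕ) : Commute (r s : M) (copyL r l (s + 2)) := by
  have hcopy : SemiconjBy (↑(r (s + 1) * r s) : M) (copyL r l s) (copyL r l (s + 2)) := by
    rw [Units.val_mul]
    exact (semiconj_copyL r l (s + 1)).mul_left (semiconj_copyL r l s)
  have hbraid : SemiconjBy (↑(r (s + 1) * r s) : M) (r (s + 1)) (r s) :=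
    congrArg Units.val ((h.braid s).symm.trans (mul_assoc _ _ _))
  have hleft := hbraid.mul_right hcopy
  have hright := hcopy.mul_right hbraid
  rw [(h.commute_copyL_of_lt s.lt_succ_self).eq] at hleft
  exact (Units.isUnit _).mul_right_cancel (hleft.eq.symm.trans hright.eq)

lemma commute_copyL_of_gt {s j : ℕ} (hs : s + 2 ≤ j) : Commute (r s : M) (copyL r l j) := by
  induction j, hs using Nat.le_induction with
  | base => exact h.commute_copyL_add_two s
  | succ j hj ih =>
    have hr : Commute (r s : M) (r j) := (h.commute hj).symm.units_val
    exact (hr.mul_right ih).mul_right hr.units_inv_right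

lemma commute_copyL_mul (s : ℕ) : Commute (r s : M) (copyL r l s * copyL r l (s + 1)) := by
  induction s with
  | zero =>
    calc (r 0 : M) * (l * (r 0 * l * ↑(r 0)⁻¹)) = r 0 * l * r 0 * l * ↑(r 0)⁻¹ := by
          simp only [mul_assoc]
      _ = l * (r 0 * l * ↑(r 0)⁻¹) * r 0 := by rw [h.reflection]; simp [mul_assoc]
  | succ s ih =>
    have hbraid : SemiconjBy (↑(r s * r (s + 1)) : M) (r s) (r (s + 1)) :=
      congrArg Units.val ((h.braid s).trans (mul_assoc _ _ _))
    have hnext : SemiconjBy (↑(r s * r (s + 1)) : M) (copyL r l (s + 1)) (copyL r l (s + 2)) := by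
      rw [Units.val_mul]
      exact SemiconjBy.mul_left (h.commute_copyL_add_two s) (semiconj_copyL r l (s + 1))
    have hprod := (h.semiconj_mul_copyL s).mul_right hnext
    have hleft := hbraid.mul_right hprod
    have hright := hprod.mul_right hbraid
    rw [ih.eq] at hleft
    exact (Units.isUnit _).mul_right_cancel (hleft.eq.symm.trans hright.eq)

lemma commute_prodL {s k : ℕ} (hs : s + 1 < k) : Commute (r s : M) (prodL r l 0 k) := by
  induction k, hs using Nat.le_induction with
  | base =>
    have hlt : ∀ m ≤ s, Commute (r s : M) (prodL r l 0 m) := by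
      intro m
      induction m with
      | zero => exact fun _ => Commute.one_right _
      | succ m ih =>
        intro hm
        exact (ih (by lia)).mul_right (h.commute_copyL_of_lt (by lia))
    simp only [prodL, zero_add, mul_assoc]
    exact (hlt s le_rfl).mul_right (h.commute_copyL_mul s)
  | succ k hk ih =>
    rw [prodL, zero_add]
    exact ih.mul_right (h.commute_copyL_of_gt hk)

lemma semiconj_ascProd_copyL (s : ℕ) {n i : ℕ} (hi : i < n) :
    SemiconjBy (↑(ascProd r s n) : M) (copyL r l (s + i)) (copyL r l (s + 1 + i)) := by
  have hi' := hi
  induction n, hi' using Nat.le_induction with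
  | base =>
    have hc : ∀ m ≤ i, Commute (↑(ascProd r s m) : M) (copyL r l (s + i + 1)) := by
      intro m
      induction m with
      | zero => exact fun _ => Commute.one_left _
      | succ m ih => exact fun hm => (ih (by lia)).mul_left (h.commute_copyL_of_gt (by lia))
    rw [add_right_comm s 1 i, ascProd, Units.val_mul]
    exact SemiconjBy.mul_left (hc i le_rfl) (semiconj_copyL r l _)
  | succ n hn ih => exact (ih hn).mul_left (h.commute_copyL_of_lt (by lia))

lemma semiconj_prodL (s : ℕ) {n m : ℕ} (hm : m ≤ n) :
    SemiconjBy (↑(ascProd r s n) : M) (prodL r l s m) (prodL r l (s + 1) m) := by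
  induction m with
  | zero => exact SemiconjBy.one_right _
  | succ m ih => exact (ih (by lia)).mul_right (h.semiconj_ascProd_copyL s hm)

end IsReflectionRep

end Braid

/-! ### Antisymmetrizers in Hecke algebras -/

section Hecke

variable {A : Type*} [Ring A] [Algebra ℂ A]

/-- Generators of an image of the Hecke algebras `H_n(q)` of type `A`, for all `n`. -/
structure IsHeckeRep (q : ℂ) (r : ℕ → Aˣ) : Prop extends IsBraidRep r where
  mul_self : ∀ i, (r i : A) * r i = (q - q⁻¹) • (r i : A) + 1

/-- The `q`-antisymmetrizers; as in `antisymm`, the index `i` stands for `A^(i+1)`. -/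
noncomputable def antisymmetrizer (q : ℂ) (r : ℕ → Aˣ) : ℕ → A
  | 0 => 1
  | i + 1 => (qNum q (i + 2))⁻¹ • (antisymmetrizer q r i *
      (q ^ (i + 1) • (1 : A) - qNum q (i + 1) • (r i : A)) * antisymmetrizer q r i)

section Idempotent

variable {q : ℂ} {r : ℕ → Aˣ} {i : ℕ}
  (hidem : IsIdempotentElem (antisymmetrizer q r i : A))
include hidem

lemma antisymmetrizer_succ_mul :
    antisymmetrizer q r (i + 1) * antisymmetrizer q r i = (antisymmetrizer q r (i + 1) : A) := by
  rw [antisymmetrizer, smul_mul_assoc, mul_assoc _ (antisymmetrizer q r i), hidem.eq]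

lemma qNum_smul_antisymmetrizer_succ (hq : qNum q (i + 2) ≠ 0) :
    qNum q (i + 2) • (antisymmetrizer q r (i + 1) : A) =
      q ^ (i + 1) • (antisymmetrizer q r i : A) -
        qNum q (i + 1) • (antisymmetrizer q r i * r i * antisymmetrizer q r i) := by
  rw [antisymmetrizer, smul_inv_smul₀ hq]
  simp only [mul_sub, sub_mul, mul_smul_comm, smul_mul_assoc, mul_one, hidem.eq]

end Idempotent

lemma mem_of_antisymmetrizer {S : Subalgebra ℂ A} {q : ℂ} {r : ℕ → Aˣ} {i : ℕ}
    (hr : ∀ s < i, (r s : A) ∈ S) : antisymmetrizer q r i ∈ S := by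
  induction i with
  | zero => exact one_mem _
  | succ i ih =>
    have hA := ih fun s hs => hr s (by lia)
    exact S.smul_mem (mul_mem (mul_mem hA (sub_mem (S.smul_mem (one_mem _) _)
      (S.smul_mem (hr i i.lt_succ_self) _))) hA) _

namespace IsHeckeRep

variable {q : ℂ} {r : ℕ → Aˣ} (h : IsHeckeRep q r)
include h

lemma inv_eq_sub (k : ℕ) : (↑(r k)⁻¹ : A) = r k - (q - q⁻¹) • (1 : A) :=
  Units.inv_eq_of_mul_eq_one_right (by simp [mul_sub, h.mul_self])

lemma commute_antisymmetrizer {i j : ℕ} (hij : i < j) :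
    Commute (r j : A) (antisymmetrizer q r i) := by
  refine (Subalgebra.mem_centralizer_iff ℂ).mp (mem_of_antisymmetrizer (S :=
    Subalgebra.centralizer ℂ {(r j : A)}) fun s hs => ?_) _ rfl
  exact (Subalgebra.mem_centralizer_iff ℂ).mpr fun _ ht =>
    ht ▸ ((h.commute (by lia)).units_val : Commute (r j : A) (r s)).eq

lemma mul_add_inv_smul (hq0 : q ≠ 0) (i : ℕ) :
    (r i : A) * (r i + q⁻¹ • 1) = q • ((r i : A) + q⁻¹ • 1) := by
  rw [mul_add, h.mul_self, mul_smul_comm, mul_one, smul_add, smul_inv_smul₀ hq0]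
  module

section Step

variable (hq0 : q ≠ 0) (hq : ∀ k : ℕ, 1 ≤ k → q ^ k ≠ 1)
include hq0 hq

/-- With `a = A^(j+2)`, `b = A^(j+1)`, `u = R_{j+2}` and `v = R_{j+1}`, the recursion for `a` gives
`(j+2)_q a u a = q^(j+1) a u - (j+1)_q a u v b`, and the second term is killed by `u + q⁻¹`, since
`a u v b u = a (u v u) b = a v u v b = -q⁻¹ a u v b`. -/
lemma qNum_smul_antisymmetrizer_mul_mul {i : ℕ}
    (hidem : ∀ j < i, IsIdempotentElem (antisymmetrizer q r j : A))
    (habs : ∀ s < i, antisymmetrizer q r i * (r s : A) = -q⁻¹ • antisymmetrizer q r i) :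
    qNum q (i + 1) • (antisymmetrizer q r i * r i * antisymmetrizer q r i *
        ((r i : A) + q⁻¹ • 1)) =
      q ^ (i + 1) • (antisymmetrizer q r i * ((r i : A) + q⁻¹ • 1)) := by
  rcases i with _ | j
  · simp [antisymmetrizer, qNum_one (sub_inv_ne_zero hq0 hq), h.mul_add_inv_smul hq0]
  have hrec := qNum_smul_antisymmetrizer_succ (hidem j j.lt_succ_self)
    (qNum_ne_zero hq0 hq (by lia))
  have hab := antisymmetrizer_succ_mul (hidem j j.lt_succ_self)
  have hav := habs j j.lt_succ_self
  have hub := h.commute_antisymmetrizer j.lt_succ_self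
  have huvu : (r (j + 1) : A) * r j * r (j + 1) = r j * r (j + 1) * r j :=
    congrArg Units.val (h.braid j).symm
  have huu := h.mul_add_inv_smul hq0 (j + 1)
  generalize (antisymmetrizer q r (j + 1) : A) = a at *
  generalize (antisymmetrizer q r j : A) = b at *
  generalize (r (j + 1) : A) = u at *
  generalize (r j : A) = v at *
  have haub : a * u * b = a * u := by rw [mul_assoc, hub.eq, ← mul_assoc, hab]
  have haua : qNum q (j + 2) • (a * u * a) =
      q ^ (j + 1) • (a * u) - qNum q (j + 1) • (a * u * v * b) := by
    rw [← mul_smul_comm, hrec]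
    simp only [mul_sub, mul_smul_comm, ← mul_assoc, haub]
  have hkill : a * u * v * b * (u + q⁻¹ • 1) = 0 := by
    have : a * u * v * b * u = -q⁻¹ • (a * u * v * b) :=
      calc a * u * v * b * u = a * (u * v * u) * b := by simp only [mul_assoc, hub.eq]
        _ = a * v * u * v * b := by rw [huvu]; simp only [mul_assoc]
        _ = -q⁻¹ • (a * u * v * b) := by rw [hav]; simp only [smul_mul_assoc]
    rw [mul_add, this, mul_smul_comm, mul_one, ← add_smul, neg_add_cancel, zero_smul]
  rw [← smul_mul_assoc, haua, sub_mul, smul_mul_assoc _ (a * u * v * b), hkill, smul_zero, sub_zero,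
    smul_mul_assoc, mul_assoc, huu, mul_smul_comm, smul_smul, pow_succ q (j + 1)]

lemma antisymmetrizer_succ_mul_last {i : ℕ}
    (hidem : ∀ j ≤ i, IsIdempotentElem (antisymmetrizer q r j : A))
    (habs : ∀ s < i, antisymmetrizer q r i * (r s : A) = -q⁻¹ • antisymmetrizer q r i) :
    antisymmetrizer q r (i + 1) * (r i : A) = -q⁻¹ • antisymmetrizer q r (i + 1) := by
  have hne : qNum q (i + 2) ≠ 0 := qNum_ne_zero hq0 hq (by lia)
  have hkill : qNum q (i + 2) • (antisymmetrizer q r (i + 1) * ((r i : A) + q⁻¹ • 1)) = 0 := by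
    rw [← smul_mul_assoc, qNum_smul_antisymmetrizer_succ (hidem i le_rfl) hne, sub_mul,
      smul_mul_assoc, smul_mul_assoc,
      h.qNum_smul_antisymmetrizer_mul_mul hq0 hq (fun j hj => hidem j hj.le) habs, sub_self]
  have := (smul_eq_zero_iff_right hne).mp hkill
  rwa [mul_add, mul_smul_comm, mul_one, add_eq_zero_iff_eq_neg, ← neg_smul] at this

omit h in
lemma isIdempotentElem_antisymmetrizer_succ {i : ℕ}
    (hidem : IsIdempotentElem (antisymmetrizer q r i : A))
    (hlast : antisymmetrizer q r (i + 1) * (r i : A) = -q⁻¹ • antisymmetrizer q r (i + 1)) :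
    IsIdempotentElem (antisymmetrizer q r (i + 1) : A) := by
  have hne : qNum q (i + 2) ≠ 0 := qNum_ne_zero hq0 hq (by lia)
  have hmul := antisymmetrizer_succ_mul hidem
  have hsucc : qNum q (i + 2) = q ^ (i + 1) + q⁻¹ * qNum q (i + 1) :=
    qNum_succ hq0 (sub_inv_ne_zero hq0 hq) (i + 1)
  refine (smul_right_inj hne).mp ?_
  conv_lhs => rw [← mul_smul_comm, qNum_smul_antisymmetrizer_succ hidem hne, mul_sub,
    mul_smul_comm, mul_smul_comm, ← mul_assoc, ← mul_assoc, hmul, hlast, smul_mul_assoc, hmul]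
  rw [hsucc]
  module

lemma antisymmetrizer_spec (i : ℕ) : IsIdempotentElem (antisymmetrizer q r i : A) ∧
    ∀ s < i, antisymmetrizer q r i * (r s : A) = -q⁻¹ • antisymmetrizer q r i := by
  induction i using Nat.strong_induction_on with
  | _ i ih =>
  rcases i with _ | i
  · exact ⟨mul_one 1, fun s hs => absurd hs s.not_lt_zero⟩
  obtain ⟨hidem, habs⟩ := ih i i.lt_succ_self
  have hlast := h.antisymmetrizer_succ_mul_last hq0 hq (fun j hj => (ih j (by lia)).1) habs
  refine ⟨isIdempotentElem_antisymmetrizer_succ hq0 hq hidem hlast, fun s hs => ?_⟩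
  rcases Nat.lt_succ_iff_lt_or_eq.mp hs with hs | rfl
  · rw [antisymmetrizer, smul_mul_assoc, mul_assoc, habs s hs, mul_smul_comm, smul_comm]
  · exact hlast

lemma isIdempotentElem_antisymmetrizer (i : ℕ) :
    IsIdempotentElem (antisymmetrizer q r i : A) :=
  (h.antisymmetrizer_spec hq0 hq i).1

lemma antisymmetrizer_mul_of_lt {i s : ℕ} (hs : s < i) :
    antisymmetrizer q r i * (r s : A) = -q⁻¹ • antisymmetrizer q r i :=
  (h.antisymmetrizer_spec hq0 hq i).2 s hs

end Step

lemma antisymmetrizer_succ_zpow (hω : q - q⁻¹ ≠ 0) (ε : ℤˣ) (i : ℕ) :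
    antisymmetrizer q r (i + 1) = (qNum q (i + 2))⁻¹ • (antisymmetrizer q r i *
      ((q ^ (ε : ℤ)) ^ (i + 1) • (1 : A) - qNum q (i + 1) • (↑(r i ^ (ε : ℤ)) : A)) *
        antisymmetrizer q r i) := by
  rw [antisymmetrizer]
  rcases Int.units_eq_one_or ε with rfl | rfl
  · simp only [Units.val_one, zpow_one]
  · have hpow : q ^ (i + 1) = q⁻¹ ^ (i + 1) + (q - q⁻¹) * qNum q (i + 1) := by
      rw [mul_qNum hω, add_sub_cancel]
    simp only [Units.val_neg, Units.val_one, zpow_neg_one, h.inv_eq_sub, hpow]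
    congr 3
    module

end IsHeckeRep

end Hecke

/-! ### Towers of algebras with traces -/

section Tower

variable {A : Type*} [Ring A] [Algebra ℂ A]

/-- The properties of the operators on `V ⊗ V ⊗ ⋯` from which the Newton identities follow: `F k`
is the algebra of operators on the first `k` factors, `E k` is the `R`-trace over the factor
number `k` (counted from `0`), `r` is the sequence of braid generators and `l` the matrix `L`. -/
structure IsReflectionTower (F : ℕ → Subalgebra ℂ A) (E : ℕ → A →ₗ[ℂ] A) (r : ℕ → Aˣ) (l : A) :
    Prop where
  mono : Monotone F
  trace_mem : ∀ {k x}, x ∈ F (k + 1) → E k x ∈ F k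
  trace_mul_left : ∀ {k y}, y ∈ F k → ∀ x, E k (y * x) = y * E k x
  trace_mul_right : ∀ {k y}, y ∈ F k → ∀ x, E k (x * y) = E k x * y
  braid_mem : ∀ k, r k ∈ (F (k + 2)).toSubmonoid.units
  commute_of_mem : ∀ {k x}, x ∈ F k → Commute (r k : A) x
  trace_conj : ∀ {k x}, x ∈ F (k + 1) → E (k + 1) (r k * x * ↑(r k)⁻¹) = E k x
  trace_trace_mul_comm : ∀ k x, E k (E (k + 1) (r k * x)) = E k (E (k + 1) (x * r k))
  braid : ∀ k, r k * r (k + 1) * r k = r (k + 1) * r k * r (k + 1)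
  l_mem : l ∈ F 1
  reflection : r 0 * l * r 0 * l = l * r 0 * l * r 0

/-- The iterated trace over the factors `s, …, s + j - 1`. -/
noncomputable def iterTrace (E : ℕ → A →ₗ[ℂ] A) (s : ℕ) : ℕ → A →ₗ[ℂ] A
  | 0 => LinearMap.id
  | j + 1 => iterTrace E s j ∘ₗ E (s + j)

/-- The functional `Z ↦ ⟨Z L̄_1 ⋯ L̄_k⟩`. -/
noncomputable def bracket (E : ℕ → A →ₗ[ℂ] A) (r : ℕ → Aˣ) (l : A) (k : ℕ) : A →ₗ[ℂ] A :=
  iterTrace E 0 k ∘ₗ LinearMap.mulRight ℂ (prodL r l 0 k)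

/-- The elements that can be moved cyclically in the bracket. -/
noncomputable def cyclicSubalgebra (E : ℕ → A →ₗ[ℂ] A) (r : ℕ → Aˣ) (l : A) (k : ℕ) :
    Subalgebra ℂ A where
  carrier := {y | (∀ x, iterTrace E 0 k (y * x) = iterTrace E 0 k (x * y)) ∧
    Commute y (prodL r l 0 k)}
  mul_mem' := by
    rintro a b ⟨ha, ha'⟩ ⟨hb, hb'⟩
    exact ⟨fun x => by rw [mul_assoc, ha, mul_assoc, hb, mul_assoc], ha'.mul_left hb'⟩
  add_mem' := by
    rintro a b ⟨ha, ha'⟩ ⟨hb, hb'⟩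
    exact ⟨fun x => by rw [add_mul, mul_add, map_add, map_add, ha, hb], ha'.add_left hb'⟩
  algebraMap_mem' c := ⟨fun x => by rw [Algebra.commutes], Algebra.commute_algebraMap_left c _⟩

/-- The elementary symmetric polynomials `a_k = ⟨A^(k) L̄_1 ⋯ L̄_k⟩`, with `a_0 = 1`. -/
noncomputable def elemBracket (q : ℂ) (E : ℕ → A →ₗ[ℂ] A) (r : ℕ → Aˣ) (l : A) : ℕ → A
  | 0 => 1
  | i + 1 => bracket E r l (i + 1) (antisymmetrizer q r i)

/-- The power sums `⟨R_{k-1}^ε ⋯ R_1^ε L̄_1 ⋯ L̄_k⟩`, of the first kind for `ε = 1` and of the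
second kind for `ε = -1`. -/
noncomputable def powerBracket (ε : ℤˣ) (E : ℕ → A →ₗ[ℂ] A) (r : ℕ → Aˣ) (l : A) : ℕ → A
  | 0 => 0
  | n + 1 => bracket E r l (n + 1) (descProd (r ^ (ε : ℤ)) 0 n : Aˣ)

lemma iterTrace_add (E : ℕ → A →ₗ[ℂ] A) (i j : ℕ) (x : A) :
    iterTrace E 0 (i + j) x = iterTrace E 0 i (iterTrace E i j x) := by
  induction j generalizing x with
  | zero => rfl
  | succ j ih => simp [← add_assoc, iterTrace, ih]

lemma bracket_apply (E : ℕ → A →ₗ[ℂ] A) (r : ℕ → Aˣ) (l : A) (k : ℕ) (z : A) :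
    bracket E r l k z = iterTrace E 0 k (z * prodL r l 0 k) := rfl

lemma bracket_mul_comm {E : ℕ → A →ₗ[ℂ] A} {r : ℕ → Aˣ} {l : A} {k : ℕ} {y : A}
    (hy : y ∈ cyclicSubalgebra E r l k) (x : A) :
    bracket E r l k (y * x) = bracket E r l k (x * y) := by
  rw [bracket_apply, bracket_apply, mul_assoc, hy.1, mul_assoc, mul_assoc, hy.2.eq]

namespace IsReflectionTower

variable {F : ℕ → Subalgebra ℂ A} {E : ℕ → A →ₗ[ℂ] A} {r : ℕ → Aˣ} {l : A}
  (h : IsReflectionTower F E r l)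
include h

lemma isReflectionRep : IsReflectionRep r l where
  braid := h.braid
  commute hij := Units.ext (h.commute_of_mem (h.mono hij (h.braid_mem _).1))
  commute_l k := h.commute_of_mem (h.mono (by lia) h.l_mem)
  reflection := h.reflection

lemma units_mono {i j : ℕ} (hij : i ≤ j) :
    (F i).toSubmonoid.units ≤ (F j).toSubmonoid.units :=
  Submonoid.units_mono (h.mono hij)

lemma copyL_mem (k : ℕ) : copyL r l k ∈ F (k + 1) := by
  induction k with
  | zero => exact h.l_mem
  | succ k ih =>
    exact mul_mem (mul_mem (h.braid_mem k).1 (h.mono (Nat.le_succ _) ih)) (h.braid_mem k).2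

lemma prodL_mem (s j : ℕ) : prodL r l s j ∈ F (s + j) := by
  induction j with
  | zero => exact one_mem _
  | succ j ih => exact mul_mem (h.mono (by lia) ih) (h.copyL_mem _)

lemma ascProd_mem (s n : ℕ) : ascProd r s n ∈ (F (s + n + 1)).toSubmonoid.units := by
  induction n with
  | zero => exact one_mem _
  | succ n ih => exact mul_mem (h.units_mono (by lia) ih) (h.braid_mem _)

lemma descProd_mem (z : ℤ) (s n : ℕ) :
    descProd (r ^ z) s n ∈ (F (s + n + 1)).toSubmonoid.units := by
  induction n with
  | zero => exact one_mem _
  | succ n ih => exact mul_mem (zpow_mem (h.braid_mem _) z) (h.units_mono (by lia) ih)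

lemma commute_descProd (z : ℤ) (s n : ℕ) {x : A} (hx : x ∈ F s) :
    Commute (↑(descProd (r ^ z) s n) : A) x := by
  induction n with
  | zero => exact Commute.one_left _
  | succ n ih =>
    have hr : Commute x (↑(r (s + n) ^ z) : A) :=
      (h.commute_of_mem (h.mono (Nat.le_add_right s n) hx)).symm.units_zpow_right z
    rw [descProd, Units.val_mul]
    exact hr.symm.mul_left ih

lemma iterTrace_mul_left (s j : ℕ) {y : A} (hy : y ∈ F s) (x : A) :
    iterTrace E s j (y * x) = y * iterTrace E s j x := by
  induction j generalizing x with
  | zero => rfl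
  | succ j ih => simp [iterTrace, h.trace_mul_left (h.mono (Nat.le_add_right s j) hy), ih]

lemma iterTrace_mul_right (s j : ℕ) {y : A} (hy : y ∈ F s) (x : A) :
    iterTrace E s j (x * y) = iterTrace E s j x * y := by
  induction j generalizing x with
  | zero => rfl
  | succ j ih => simp [iterTrace, h.trace_mul_right (h.mono (Nat.le_add_right s j) hy), ih]

lemma iterTrace_mem (s j : ℕ) {x : A} (hx : x ∈ F (s + j)) : iterTrace E s j x ∈ F s := by
  induction j generalizing x with
  | zero => exact hx
  | succ j ih => exact ih (h.trace_mem hx)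

lemma iterTrace_ascProd_conj (s n : ℕ) {x : A} (hx : x ∈ F (s + n)) :
    iterTrace E (s + 1) n (↑(ascProd r s n) * x * ↑(ascProd r s n)⁻¹) = iterTrace E s n x := by
  induction n generalizing x with
  | zero => simp [ascProd, iterTrace]
  | succ n ih =>
    have hmem : (↑(ascProd r s n) : A) ∈ F (s + n + 1) := (h.ascProd_mem s n).1
    have hinv_mem : (↑(ascProd r s n)⁻¹ : A) ∈ F (s + n + 1) := (h.ascProd_mem s n).2
    have hconj : (↑(ascProd r s (n + 1)) : A) * x * ↑(ascProd r s (n + 1))⁻¹ =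
        ↑(ascProd r s n) * (r (s + n) * x * ↑(r (s + n))⁻¹ * ↑(ascProd r s n)⁻¹) := by
      simp [ascProd, mul_assoc]
    simp only [iterTrace, LinearMap.comp_apply]
    rw [hconj, add_right_comm s 1 n, h.trace_mul_left hmem, h.trace_mul_right hinv_mem,
      h.trace_conj (k := s + n) hx, ← mul_assoc, ih (h.trace_mem hx)]

/-- Conjugation by the braid `R_{s+1} ⋯ R_{s+n+1}` moves the operator by one factor to the
right. -/
lemma iterTrace_descProd_mul_prodL (z : ℤ) (s n : ℕ) :
    iterTrace E s (n + 1) (↑(descProd (r ^ z) s n) * prodL r l s (n + 1)) =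
      bracket E r l (n + 1) (descProd (r ^ z) 0 n : Aˣ) := by
  induction s with
  | zero => rfl
  | succ s ih =>
    have hdesc : SemiconjBy (↑(ascProd r s (n + 1)) : A) ↑(descProd (r ^ z) s n)
        ↑(descProd (r ^ z) (s + 1) n) :=
      congrArg Units.val (h.isReflectionRep.semiconj_descProd z s n.lt_succ_self).eq
    have hsemi := hdesc.mul_right (h.isReflectionRep.semiconj_prodL s (le_refl (n + 1)))
    have hmem : (↑(descProd (r ^ z) s n) : A) * prodL r l s (n + 1) ∈ F (s + (n + 1)) :=
      mul_mem (h.descProd_mem z s n).1 (h.prodL_mem s (n + 1))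
    rw [← ih, ← h.iterTrace_ascProd_conj s (n + 1) hmem, hsemi.eq, Units.mul_inv_cancel_right]

lemma bracket_mul (z : ℤ) (i n : ℕ) {y : A} (hy : y ∈ F i) :
    bracket E r l (i + (n + 1)) (y * ↑(descProd (r ^ z) i n)) =
      bracket E r l i y * bracket E r l (n + 1) (descProd (r ^ z) 0 n : Aˣ) := by
  have hL : prodL r l 0 i ∈ F i := by simpa using h.prodL_mem 0 i
  have hscalar : bracket E r l (n + 1) (descProd (r ^ z) 0 n : Aˣ) ∈ F 0 := by
    refine h.iterTrace_mem 0 (n + 1) (mul_mem ?_ (h.prodL_mem 0 (n + 1)))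
    exact add_assoc 0 n 1 ▸ (h.descProd_mem z 0 n).1
  calc bracket E r l (i + (n + 1)) (y * ↑(descProd (r ^ z) i n))
      = iterTrace E 0 i (iterTrace E i (n + 1)
          ((y * prodL r l 0 i) * (↑(descProd (r ^ z) i n) * prodL r l i (n + 1)))) := by
        rw [bracket_apply, iterTrace_add, prodL_add, mul_assoc, ← mul_assoc _ (prodL r l 0 i),
          (h.commute_descProd z i n hL).eq, mul_assoc, ← mul_assoc]
    _ = iterTrace E 0 i ((y * prodL r l 0 i) *
          bracket E r l (n + 1) (descProd (r ^ z) 0 n : Aˣ)) := by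
        rw [h.iterTrace_mul_left i _ (mul_mem hy hL), h.iterTrace_descProd_mul_prodL]
    _ = bracket E r l i y * bracket E r l (n + 1) (descProd (r ^ z) 0 n : Aˣ) :=
        h.iterTrace_mul_right 0 i hscalar _

lemma iterTrace_braid_mul_comm {s k : ℕ} (hs : s + 1 < k) (x : A) :
    iterTrace E 0 k (r s * x) = iterTrace E 0 k (x * r s) := by
  induction k, hs using Nat.le_induction generalizing x with
  | base => simp only [iterTrace, LinearMap.comp_apply, zero_add, h.trace_trace_mul_comm]
  | succ k hk ih =>
    have hmem : (r s : A) ∈ F k := h.mono hk (h.braid_mem s).1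
    simp only [iterTrace, LinearMap.comp_apply, zero_add, h.trace_mul_left hmem,
      h.trace_mul_right hmem, ih]

lemma braid_mem_cyclicSubalgebra {s k : ℕ} (hs : s + 1 < k) :
    r s ∈ (cyclicSubalgebra E r l k).toSubmonoid.units := by
  have hcomm := h.isReflectionRep.commute_prodL hs
  refine (Submonoid.mem_units_iff _ _).mpr ⟨⟨h.iterTrace_braid_mul_comm hs, hcomm⟩,
    ⟨fun x => ?_, hcomm.units_inv_left⟩⟩
  have := h.iterTrace_braid_mul_comm hs (↑(r s)⁻¹ * x * ↑(r s)⁻¹)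
  simp only [mul_assoc, Units.mul_inv_cancel_left, Units.inv_mul, mul_one] at this
  exact this.symm

section Hecke

variable {q : ℂ}

lemma antisymmetrizer_mem (i : ℕ) : antisymmetrizer q r i ∈ F (i + 1) :=
  mem_of_antisymmetrizer fun s hs => h.mono (by lia) (h.braid_mem s).1

lemma antisymmetrizer_mem_cyclicSubalgebra {i k : ℕ} (hi : i < k) :
    antisymmetrizer q r i ∈ cyclicSubalgebra E r l k :=
  mem_of_antisymmetrizer fun s hs => (h.braid_mem_cyclicSubalgebra (by lia)).1

variable (hq0 : q ≠ 0) (hq : ∀ k : ℕ, 1 ≤ k → q ^ k ≠ 1) (hr : IsHeckeRep q r)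
include hq0 hq hr

/-- By cyclicity and idempotency, `⟨A R_i^ε A ⋯⟩ = ⟨A ⋯ R_i^ε⟩`, which lengthens the product of the
generators by one factor. -/
lemma bracket_antisymmetrizer_mul_zpow_mul (ε : ℤˣ) (i n : ℕ) :
    bracket E r l (i + 1 + (n + 1)) (antisymmetrizer q r i * ↑(r i ^ (ε : ℤ)) *
        antisymmetrizer q r i * ↑(descProd (r ^ (ε : ℤ)) (i + 1) n)) =
      bracket E r l (i + 1 + (n + 1))
        (antisymmetrizer q r i * ↑(descProd (r ^ (ε : ℤ)) i (n + 1))) := by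
  have hcomm := (h.commute_descProd (ε : ℤ) (i + 1) n (h.antisymmetrizer_mem (q := q) i)).eq
  have hidem := (hr.isIdempotentElem_antisymmetrizer hq0 hq i).eq
  have hcyc := bracket_mul_comm (h.antisymmetrizer_mem_cyclicSubalgebra (q := q)
    (show i < i + 1 + (n + 1) by lia))
  have hzcyc : ∀ x, bracket E r l (i + 1 + (n + 1)) (↑(r i ^ (ε : ℤ)) * x) =
      bracket E r l (i + 1 + (n + 1)) (x * ↑(r i ^ (ε : ℤ))) :=
    bracket_mul_comm (zpow_mem (h.braid_mem_cyclicSubalgebra (by lia)) (ε : ℤ)).1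
  rw [descProd_succ', Pi.pow_apply, Units.val_mul]
  generalize (antisymmetrizer q r i : A) = a at *
  generalize (↑(descProd (r ^ (ε : ℤ)) (i + 1) n) : A) = d at *
  generalize (↑(r i ^ (ε : ℤ)) : A) = u at *
  generalize bracket E r l (i + 1 + (n + 1)) = f at *
  calc f (a * u * a * d) = f (a * (u * d * a)) := by
        rw [mul_assoc (a * u), ← hcomm]; simp only [mul_assoc]
    _ = f (u * d * (a * a)) := by rw [hcyc, mul_assoc]
    _ = f (d * a * u) := by rw [hidem, mul_assoc, hzcyc]
    _ = f (a * (d * u)) := by rw [hcomm, mul_assoc]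

lemma newton_step (ε : ℤˣ) (i n : ℕ) :
    qNum q (i + 2) • bracket E r l (i + 1 + (n + 1))
        (antisymmetrizer q r (i + 1) * ↑(descProd (r ^ (ε : ℤ)) (i + 1) n)) =
      (q ^ (ε : ℤ)) ^ (i + 1) • (elemBracket q E r l (i + 1) * powerBracket ε E r l (n + 1)) -
      qNum q (i + 1) • bracket E r l (i + (n + 1 + 1))
        (antisymmetrizer q r i * ↑(descProd (r ^ (ε : ℤ)) i (n + 1))) := by
  rw [elemBracket, powerBracket, ← h.bracket_mul ε (i + 1) n (h.antisymmetrizer_mem i),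
    show i + (n + 1 + 1) = i + 1 + (n + 1) by lia,
    ← h.bracket_antisymmetrizer_mul_zpow_mul hq0 hq hr,
    hr.antisymmetrizer_succ_zpow (sub_inv_ne_zero hq0 hq) ε, smul_mul_assoc, map_smul,
    smul_inv_smul₀ (qNum_ne_zero hq0 hq (by lia)), ← map_smul, ← map_smul, ← map_sub]
  simp only [mul_sub, sub_mul, mul_smul_comm, smul_mul_assoc, mul_one,
    (hr.isIdempotentElem_antisymmetrizer hq0 hq i).eq]

lemma qNum_smul_bracket (ε : ℤˣ) (j n : ℕ) :
    qNum q (j + 1) • bracket E r l (j + (n + 1))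
        (antisymmetrizer q r j * ↑(descProd (r ^ (ε : ℤ)) j n)) =
      ∑ i ∈ range (j + 1), ((-1) ^ (j - i) * (q ^ (ε : ℤ)) ^ i) •
        (elemBracket q E r l i * powerBracket ε E r l (j + (n + 1) - i)) := by
  induction j generalizing n with
  | zero => simp [qNum_one (sub_inv_ne_zero hq0 hq), antisymmetrizer, elemBracket, powerBracket]
  | succ j ih =>
    rw [h.newton_step hq0 hq hr, ih, sum_range_succ _ (j + 1), Nat.add_sub_cancel_left,
      sub_eq_neg_add, ← sum_neg_distrib, Nat.sub_self, pow_zero, one_mul]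
    congr 1
    refine sum_congr rfl fun i hi => ?_
    have hij : i ≤ j := Nat.lt_succ_iff.mp (mem_range.mp hi)
    rw [Nat.succ_sub hij, pow_succ, show j + 1 + (n + 1) - i = j + (n + 1 + 1) - i by lia]
    module

theorem newton_elemBracket (ε : ℤˣ) (k : ℕ) :
    qNum q (k + 1) • elemBracket q E r l (k + 1) =
      ∑ i ∈ range (k + 1), ((-1) ^ (k - i) * (q ^ (ε : ℤ)) ^ i) •
        (elemBracket q E r l i * powerBracket ε E r l (k + 1 - i)) := by
  simpa [descProd, elemBracket] using h.qNum_smul_bracket hq0 hq hr ε k 0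

end Hecke

end IsReflectionTower

end Tower

/-! ### Operators on functions of infinite words -/

section Extend

variable {α β γ : Type*} {f : α → β}

lemma extend_eq_iff (hf : f.Injective) {g : α → γ} {e u : β → γ} :
    Function.extend f g e = u ↔ g = u ∘ f ∧ ∀ k, (¬ ∃ i, f i = k) → e k = u k := by
  refine ⟨?_, fun h => funext fun k => ?_⟩
  · rintro rfl
    exact ⟨(Function.extend_comp hf g e).symm, fun k hk => (Function.extend_apply' _ _ _ hk).symm⟩
  · by_cases hk : ∃ i, f i = k
    · obtain ⟨i, rfl⟩ := hk
      rw [hf.extend_apply, h.1, Function.comp_apply]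
    · rw [Function.extend_apply' _ _ _ hk, h.2 k hk]

lemma extend_comp_self (hf : f.Injective) (e : β → γ) : Function.extend f (e ∘ f) e = e :=
  (extend_eq_iff hf).2 ⟨rfl, fun _ _ => rfl⟩

lemma extend_extend (hf : f.Injective) (g g' : α → γ) (e : β → γ) :
    Function.extend f g (Function.extend f g' e) = Function.extend f g e :=
  (extend_eq_iff hf).2 ⟨(Function.extend_comp hf g e).symm, fun k hk => by
    rw [Function.extend_apply' _ _ _ hk, Function.extend_apply' _ _ _ hk]⟩

lemma extend_update [DecidableEq α] [DecidableEq β] (hf : f.Injective) (g : α → γ) (e : β → γ)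
    (i : α) (c : γ) :
    Function.extend f (Function.update g i c) e =
      Function.update (Function.extend f g e) (f i) c := by
  refine (extend_eq_iff hf).2 ⟨?_, fun k hk => ?_⟩
  · rw [Function.update_comp_eq_of_injective _ hf, Function.extend_comp hf]
  · rw [Function.update_of_ne (fun h => hk ⟨i, h.symm⟩), Function.extend_apply' _ _ _ hk]

lemma extend_val_snoc {n : ℕ} (w : Fin n → γ) (c : γ) (v : ℕ → γ) :
    Function.extend Fin.val (Fin.snoc w c : Fin (n + 1) → γ) v =
      Function.update (Function.extend Fin.val w v) n c := by
  refine (extend_eq_iff Fin.val_injective).2 ⟨funext fun k => ?_, fun k hk => ?_⟩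
  · cases k using Fin.lastCases with
    | last => simp
    | cast k => simp [k.isLt.ne, Fin.val_injective.extend_apply]
  · have hlt : ¬ ∃ i : Fin n, i.val = k := fun ⟨i, hi⟩ => hk ⟨i.castSucc, hi⟩
    have hkn : k ≠ n := fun h => hk ⟨Fin.last n, h.symm⟩
    rw [Function.update_of_ne hkn, Function.extend_apply' _ _ _ hlt]

lemma update_val_comp_val {n : ℕ} (v : ℕ → γ) (b : γ) :
    (Function.update v n b ∘ Fin.val : Fin (n + 1) → γ) = Fin.snoc (v ∘ Fin.val : Fin n → γ) b := by
  funext k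
  cases k using Fin.lastCases with
  | last => simp
  | cast k => simp [k.isLt.ne]

lemma update_extend_val_update {n : ℕ} (w : Fin n → γ) (v : ℕ → γ) (b : γ) :
    Function.update (Function.extend Fin.val w (Function.update v n b)) n (v n) =
      Function.extend Fin.val w v := by
  refine ((extend_eq_iff Fin.val_injective).2 ⟨funext fun k => ?_, fun k hk => ?_⟩).symm
  · simp [k.isLt.ne, Fin.val_injective.extend_apply]
  · rcases eq_or_ne k n with rfl | hkn
    · simp
    · rw [Function.update_of_ne hkn, Function.extend_apply' _ _ _ hk, Function.update_of_ne hkn]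

end Extend

lemma sum_oneSite_mul {S : Type*} [NonUnitalNonAssocSemiring S] {N n : ℕ} (i : Fin n)
    (M : Matrix (Fin N) (Fin N) S) (v : Fin n → Fin N) (g : (Fin n → Fin N) → S) :
    ∑ w, oneSite i M v w * g w = ∑ b, M (v i) b * g (Function.update v i b) := by
  refine (Fintype.sum_of_injective (Function.update v i) (Function.update_injective v i)
    _ _ (fun w hw => ?_) fun b => ?_).symm
  · suffices ¬ ∀ k, k ≠ i → v k = w k by simp [oneSite, this]
    refine fun h => hw ⟨w i, funext fun k => ?_⟩
    grind [Function.update_apply]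
  · have hfix : ∀ k, k ≠ i → v k = Function.update v i b k := fun k hk => by simp [hk]
    simp [oneSite, if_pos hfix]

section Op

variable {N : ℕ} {S : Type*} [Ring S] [Algebra ℂ S]

/-- The operators on `S`-valued functions of infinite words. Words of length `n` act on all of
them, which puts the algebras of operators on all tensor powers of `V` into a single ring. -/
abbrev Op (N : ℕ) (S : Type*) [Ring S] [Algebra ℂ S] : Type _ := Module.End ℂ ((ℕ → Fin N) → S)

/-- The matrix units acting on the letter number `k`. -/
def unitOp (S : Type*) [Ring S] [Algebra ℂ S] (k : ℕ) (a b : Fin N) : Op N S where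
  toFun φ v := if v k = a then φ (Function.update v k b) else 0
  map_add' φ ψ := by ext v; simp only [Pi.add_apply]; split_ifs <;> simp
  map_smul' c φ := by ext v; simp

lemma unitOp_apply (k : ℕ) (a b : Fin N) (φ : (ℕ → Fin N) → S) (v : ℕ → Fin N) :
    unitOp S k a b φ v = if v k = a then φ (Function.update v k b) else 0 := rfl

variable (N S) in
lemma isCommutingMatrixUnits_unitOp : IsCommutingMatrixUnits (unitOp (N := N) S) where
  isMatrixUnits k :=
    { mul a b c d := by
        ext φ v
        by_cases h : b = c <;> simp [unitOp_apply, h]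
      sum_diag := by
        ext φ v
        simp [LinearMap.sum_apply, Finset.sum_apply, unitOp_apply] }
  commute {i j} hij a b c d := by
    ext φ v
    simp only [Module.End.mul_apply, unitOp_apply, Function.update_of_ne hij,
      Function.update_of_ne hij.symm, Function.update_comm hij]
    split_ifs <;> rfl

/-- Left multiplication of `S`-valued functions by elements of `S`. -/
def mulOp (N : ℕ) (S : Type*) [Ring S] [Algebra ℂ S] : S →ₐ[ℂ] Op N S :=
  Algebra.lsmul ℂ ℂ ((ℕ → Fin N) → S)

lemma mulOp_apply (s : S) (φ : (ℕ → Fin N) → S) (v : ℕ → Fin N) :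
    mulOp N S s φ v = s * φ v := rfl

lemma mulOp_injective [Nonempty (Fin N)] : Function.Injective (mulOp N S) := by
  intro s t h
  obtain ⟨a⟩ := ‹Nonempty (Fin N)›
  simpa [mulOp_apply] using congrFun (LinearMap.congr_fun h 1) fun _ => a

lemma commute_mulOp_unitOp (s : S) (k : ℕ) (a b : Fin N) :
    Commute (mulOp N S s) (unitOp S k a b) := by
  ext φ v
  simp [mulOp_apply, unitOp_apply]

/-- Matrices over `S` with rows and columns indexed by words of length `n`, acting on the letters
`f 0, …, f (n - 1)` of infinite words. -/
noncomputable def matOp {n : ℕ} (f : Fin n → ℕ) (hf : f.Injective) :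
    Matrix (Fin n → Fin N) (Fin n → Fin N) S →ₐ[ℂ] Op N S :=
  AlgHom.ofLinearMap
    { toFun := fun M =>
        { toFun := fun φ v => ∑ w, M (v ∘ f) w * φ (Function.extend f w v)
          map_add' := fun φ ψ => by ext v; simp [mul_add, sum_add_distrib]
          map_smul' := fun c φ => by ext v; simp [smul_sum] }
      map_add' := fun M M' => by ext φ v; simp [add_mul, sum_add_distrib]
      map_smul' := fun c M => by ext φ v; simp [smul_sum] }
    (by
      ext φ v
      simp [Matrix.one_apply, extend_comp_self hf])
    (by
      intro M M'
      ext φ v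
      simp only [LinearMap.coe_mk, AddHom.coe_mk, Module.End.mul_apply, Function.extend_comp hf,
        extend_extend hf, Matrix.mul_apply, sum_mul, mul_sum]
      rw [sum_comm]
      simp only [mul_assoc])

lemma matOp_apply {n : ℕ} (f : Fin n → ℕ) (hf : f.Injective)
    (M : Matrix (Fin n → Fin N) (Fin n → Fin N) S) (φ : (ℕ → Fin N) → S) (v : ℕ → Fin N) :
    matOp f hf M φ v = ∑ w, M (v ∘ f) w * φ (Function.extend f w v) := rfl

lemma matOp_injective [Nonempty (Fin N)] {n : ℕ}
    (f : Fin n → ℕ) (hf : f.Injective) : Function.Injective (matOp (N := N) (S := S) f hf) := by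
  intro M M' h
  obtain ⟨a⟩ := ‹Nonempty (Fin N)›
  ext v w
  have hvw := congrFun (LinearMap.congr_fun h fun u => if u ∘ f = w then 1 else 0)
    (Function.extend f v fun _ => a)
  simpa [matOp_apply, Function.extend_comp hf] using hvw

lemma pair_unitOp_apply {i j : ℕ} (hij : i ≠ j) (M : Matrix (Fin N × Fin N) (Fin N × Fin N) ℂ)
    (φ : (ℕ → Fin N) → S) (v : ℕ → Fin N) :
    pair (unitOp S) i j M φ v = ∑ p, M (v i, v j) p •
      φ (Function.update (Function.update v i p.1) j p.2) := by
  have hunit (p r : Fin N × Fin N) : (unitOp S i p.1 r.1 * unitOp S j p.2 r.2) φ v =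
      if (v i, v j) = p then φ (Function.update (Function.update v i r.1) j r.2) else 0 := by
    simp only [Module.End.mul_apply, unitOp_apply, Function.update_of_ne hij.symm, ← ite_and,
      Prod.ext_iff]
  simp only [pair, ofUnits_apply, LinearMap.sum_apply, Finset.sum_apply, LinearMap.smul_apply,
    Pi.smul_apply, hunit, smul_ite, smul_zero]
  rw [sum_comm]
  simp only [sum_ite_eq, mem_univ, if_true]

lemma matOp_twoSite {n : ℕ} (f : Fin (n + 1) → ℕ) (hf : f.Injective) (i : Fin n)
    (M : Matrix (Fin N × Fin N) (Fin N × Fin N) ℂ) :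
    matOp f hf ((twoSite i M).map (algebraMap ℂ S)) =
      pair (unitOp S) (f i.castSucc) (f i.succ) M := by
  have hmap : (twoSite i M).map (algebraMap ℂ S) = twoSite i (M.map (algebraMap ℂ S)) := by
    ext v w
    simp only [twoSite, Matrix.map_apply, Matrix.of_apply]
    split_ifs <;> simp
  ext φ v
  rw [matOp_apply, hmap, sum_twoSite_mul, pair_unitOp_apply (hf.ne Fin.castSucc_lt_succ.ne)]
  simp only [extend_update hf, extend_comp_self hf, Matrix.map_apply, Algebra.smul_def,
    Function.comp_apply]

/-- The matrix `L` over `S` acting on the letter number `0`. -/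
def firstOp (L : Matrix (Fin N) (Fin N) S) : Op N S :=
  ∑ a, ∑ b, mulOp N S (L a b) * unitOp S 0 a b

lemma firstOp_apply (L : Matrix (Fin N) (Fin N) S) (φ : (ℕ → Fin N) → S) (v : ℕ → Fin N) :
    firstOp L φ v = ∑ b, L (v 0) b * φ (Function.update v 0 b) := by
  simp [firstOp, LinearMap.sum_apply, Finset.sum_apply, mulOp_apply, unitOp_apply]

lemma matOp_oneSite {n : ℕ} (f : Fin (n + 1) → ℕ) (hf : f.Injective) (h0 : f 0 = 0)
    (L : Matrix (Fin N) (Fin N) S) : matOp f hf (oneSite 0 L) = firstOp L := by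
  ext φ v
  simp only [matOp_apply, firstOp_apply, sum_oneSite_mul, extend_update hf, extend_comp_self hf,
    Function.comp_apply, h0]

/-- The partial trace over the last factor of `V^{⊗(n+1)}`, weighted by `C`. -/
def lastTrace (C : Matrix (Fin N) (Fin N) ℂ) {n : ℕ}
    (M : Matrix (Fin (n + 1) → Fin N) (Fin (n + 1) → Fin N) S) :
    Matrix (Fin n → Fin N) (Fin n → Fin N) S :=
  .of fun v w => ∑ a, ∑ b, C a b • M (Fin.snoc v b) (Fin.snoc w a)

lemma trace_map_tensorPow_mul (C : Matrix (Fin N) (Fin N) ℂ) {n : ℕ}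
    (M : Matrix (Fin n → Fin N) (Fin n → Fin N) S) :
    ((tensorPow C n).map (algebraMap ℂ S) * M).trace = ∑ v, ∑ w, tensorPow C n v w • M w v := by
  simp [Matrix.trace, Matrix.mul_apply, Algebra.smul_def]

lemma sum_eq_sum_sum_snoc {α T : Type*} [Fintype α] [AddCommMonoid T] {n : ℕ}
    (g : (Fin (n + 1) → α) → T) : ∑ v, g v = ∑ v : Fin n → α, ∑ a, g (Fin.snoc v a) := by
  rw [← (Fin.snocEquiv fun _ : Fin (n + 1) => α).sum_comp, Fintype.sum_prod_type, sum_comm]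
  rfl

lemma trace_map_tensorPow_succ_mul (C : Matrix (Fin N) (Fin N) ℂ) {n : ℕ}
    (M : Matrix (Fin (n + 1) → Fin N) (Fin (n + 1) → Fin N) S) :
    ((tensorPow C (n + 1)).map (algebraMap ℂ S) * M).trace =
      ((tensorPow C n).map (algebraMap ℂ S) * lastTrace C M).trace := by
  have hpow (v w : Fin n → Fin N) (a b : Fin N) :
      tensorPow C (n + 1) (Fin.snoc v a) (Fin.snoc w b) = tensorPow C n v w * C a b := by
    simp [tensorPow, Fin.prod_univ_castSucc]
  simp only [trace_map_tensorPow_mul, sum_eq_sum_sum_snoc (n := n), hpow, lastTrace,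
    Matrix.of_apply, smul_sum, smul_smul]
  exact sum_congr rfl fun v _ => sum_comm

lemma entry_unitOp_apply (k : ℕ) (a b : Fin N) (X : Op N S) (φ : (ℕ → Fin N) → S)
    (v : ℕ → Fin N) :
    entry ℂ (unitOp S) k a b X φ v = X (unitOp S k b (v k) φ) (Function.update v k a) := by
  simp [entry_apply, LinearMap.sum_apply, Finset.sum_apply, unitOp_apply (k := k) (b := a)]

lemma weightedTrace_unitOp_matOp (C : Matrix (Fin N) (Fin N) ℂ) {n : ℕ}
    (M : Matrix (Fin (n + 1) → Fin N) (Fin (n + 1) → Fin N) S) :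
    weightedTrace (unitOp S) C n (matOp Fin.val Fin.val_injective M) =
      matOp Fin.val Fin.val_injective (lastTrace C M) := by
  have hentry (a b : Fin N) (φ : (ℕ → Fin N) → S) (v : ℕ → Fin N) :
      entry ℂ (unitOp S) n b a (matOp Fin.val Fin.val_injective M) φ v =
        ∑ w : Fin n → Fin N, M (Fin.snoc (v ∘ Fin.val) b) (Fin.snoc w a) *
          φ (Function.extend Fin.val w v) := by
    simp [entry_unitOp_apply, matOp_apply, sum_eq_sum_sum_snoc (n := n), update_val_comp_val,
      extend_val_snoc, unitOp_apply, update_extend_val_update]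
  ext φ v
  rw [(isCommutingMatrixUnits_unitOp N S).weightedTrace_eq_sum_entry, matOp_apply]
  simp only [LinearMap.sum_apply, Finset.sum_apply, LinearMap.smul_apply, Pi.smul_apply, hentry,
    lastTrace, Matrix.of_apply, smul_sum, sum_mul, smul_mul_assoc]
  rw [sum_comm (s := (univ : Finset (Fin n → Fin N)))]
  exact sum_congr rfl fun a _ => sum_comm

lemma iterTrace_weightedTrace_matOp (C : Matrix (Fin N) (Fin N) ℂ) {n : ℕ}
    (M : Matrix (Fin n → Fin N) (Fin n → Fin N) S) :
    iterTrace (weightedTrace (unitOp S) C) 0 n (matOp Fin.val Fin.val_injective M) =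
      mulOp N S ((tensorPow C n).map (algebraMap ℂ S) * M).trace := by
  induction n with
  | zero =>
    ext φ v
    have hextend (w : Fin 0 → Fin N) : Function.extend Fin.val w v = v :=
      Function.extend_of_isEmpty _ _ _
    rw [trace_map_tensorPow_mul]
    simp [iterTrace, matOp_apply, mulOp_apply, hextend, tensorPow,
      Subsingleton.elim _ (default : Fin 0 → Fin N)]
  | succ n ih =>
    rw [trace_map_tensorPow_succ_mul, ← ih, iterTrace, LinearMap.comp_apply, zero_add,
      weightedTrace_unitOp_matOp]

end Op

/-! ### Vanishing of skew-symmetric operators above the bi-rank -/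

lemma ofFn_update {α : Type*} {n : ℕ} (w : Fin n → α) (i : Fin n) (c : α) :
    List.ofFn (Function.update w i c) = (List.ofFn w).set i c := by
  refine List.ext_getElem (by simp) fun k _ _ => ?_
  simp [List.getElem_set, Function.update_apply, Fin.ext_iff, eq_comm]

lemma sum_mul_twoSite {S : Type*} [CommSemiring S] {N n : ℕ} (i : Fin n)
    (M : Matrix (Fin N × Fin N) (Fin N × Fin N) S) (v : Fin (n + 1) → Fin N)
    (g : (Fin (n + 1) → Fin N) → S) :
    ∑ w, g w * twoSite i M w v = ∑ p : Fin N × Fin N,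
      M p (v i.castSucc, v i.succ) *
        g (Function.update (Function.update v i.castSucc p.1) i.succ p.2) := by
  have htranspose (w : Fin (n + 1) → Fin N) : twoSite i M w v = twoSite i M.transpose v w := by
    simp [twoSite, eq_comm]
  simp_rw [htranspose, mul_comm (g _), sum_twoSite_mul, Matrix.transpose_apply]

section Vanishing

variable {N : ℕ}

/-- The linear functionals on the tensor algebra of `V`, given by their values on words, that
vanish on the ideal generated by the image of `M`. -/
def idealAnnihilator (M : Matrix (Fin N × Fin N) (Fin N × Fin N) ℂ) :
    Submodule ℂ (List (Fin N) → ℂ) where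
  carrier := {f | ∀ u v j, ∑ i, M i j * f (u ++ i.1 :: i.2 :: v) = 0}
  add_mem' hf hg u v j := by simp [mul_add, sum_add_distrib, hf u v j, hg u v j]
  zero_mem' u v j := by simp
  smul_mem' c f hf u v j := by simp [mul_left_comm _ c, ← mul_sum, hf u v j]

/-- The transpose of right multiplication by a basis vector. -/
def appendLetter (M : Matrix (Fin N × Fin N) (Fin N × Fin N) ℂ) (a : Fin N) :
    Module.End ℂ (idealAnnihilator M) :=
  (LinearMap.funLeft ℂ ℂ (· ++ [a])).restrict fun f hf u v j => by
    simpa using hf u (v ++ [a]) j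

lemma appendLetter_apply (M : Matrix (Fin N × Fin N) (Fin N × Fin N) ℂ) (a : Fin N)
    (f : idealAnnihilator M) (u : List (Fin N)) :
    (appendLetter M a f).1 u = f.1 (u ++ [a]) := rfl

variable (q : ℂ) (R : Matrix (Fin N × Fin N) (Fin N × Fin N) ℂ)

/-- The action of the skew-symmetric algebra on the linear functionals on it. -/
noncomputable def skewAction : SkewAlgebra q R →ₐ[ℂ]
    Module.End ℂ (idealAnnihilator (q⁻¹ • (1 : Matrix (Fin N × Fin N) (Fin N × Fin N) ℂ) + R)) :=
  RingQuot.liftAlgHom ℂ ⟨FreeAlgebra.lift ℂ (appendLetter _), by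
    rintro _ _ ⟨j⟩
    ext f u
    simpa [LinearMap.sum_apply, appendLetter_apply] using f.2 u [] j⟩

lemma exists_mem_skewComponent (l : List (Fin N)) :
    ∃ x ∈ skewComponent q R l.length, ∀ f u, (skewAction q R x f).1 u = f.1 (u ++ l) := by
  induction l with
  | nil =>
    refine ⟨1, ?_, by simp⟩
    rw [skewComponent, List.length_nil, pow_zero]
    exact Submodule.one_le.mp le_rfl
  | cons a l ih =>
    obtain ⟨x, hx, hxf⟩ := ih
    refine ⟨RingQuot.mkAlgHom ℂ (SkewRel q R) (FreeAlgebra.ι ℂ a) * x, ?_, fun f u => ?_⟩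
    · rw [skewComponent, List.length_cons, pow_succ']
      exact Submodule.mul_mem_mul (Submodule.subset_span ⟨_, rfl⟩) hx
    · have hι : skewAction q R (RingQuot.mkAlgHom ℂ (SkewRel q R) (FreeAlgebra.ι ℂ a)) =
          appendLetter _ a := by
        simp [skewAction]
      rw [map_mul, Module.End.mul_apply, hι, appendLetter_apply, hxf, List.append_assoc,
        List.singleton_append]

variable {q R}

lemma HasBiRank.skewComponent_eq_bot {m n : ℕ} (hm : HasBiRank q R m) (hn : m < n) :
    skewComponent q R n = ⊥ := by
  obtain ⟨H, rfl, hH⟩ := hm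
  have : Module.Finite ℂ (skewComponent q R n) :=
    Module.Finite.iff_fg.mpr ((Submodule.fg_span (Set.finite_range _)).pow n)
  have hcoeff := congrArg (PowerSeries.coeff n) hH
  rw [Polynomial.coeff_coe, Polynomial.coeff_eq_zero_of_natDegree_lt hn, skewHilbertSeries,
    PowerSeries.coeff_mk] at hcoeff
  exact Submodule.finrank_eq_zero.mp hcoeff.symm

lemma HasBiRank.apply_eq_zero {m : ℕ} (hm : HasBiRank q R m) {f : List (Fin N) → ℂ}
    (hf : f ∈ idealAnnihilator (q⁻¹ • 1 + R)) {l : List (Fin N)} (hl : m < l.length) :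
    f l = 0 := by
  obtain ⟨x, hx, hxf⟩ := exists_mem_skewComponent q R l
  rw [hm.skewComponent_eq_bot hl, Submodule.mem_bot] at hx
  simpa [hx, eq_comm] using hxf ⟨f, hf⟩ []

lemma extend_ofFn_mem_idealAnnihilator {n : ℕ} {M : Matrix (Fin N × Fin N) (Fin N × Fin N) ℂ}
    {z : (Fin (n + 1) → Fin N) → ℂ} (hz : ∀ i : Fin n, z ᵥ* twoSite i M = 0) :
    Function.extend List.ofFn z 0 ∈ idealAnnihilator M := by
  intro u v j
  by_cases hlen : u.length + (v.length + 2) = n + 1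
  · let i : Fin n := ⟨u.length, by lia⟩
    let w : Fin (n + 1) → Fin N := fun k =>
      (u ++ j.1 :: j.2 :: v)[k.val]'(by simpa [hlen] using k.isLt)
    have hw : List.ofFn w = u ++ j.1 :: j.2 :: v :=
      List.ext_getElem (by simp [-List.ofFn_succ, hlen]) (by simp [-List.ofFn_succ, w])
    have hupdate (p : Fin N × Fin N) : List.ofFn (Function.update
        (Function.update w i.castSucc p.1) i.succ p.2) = u ++ p.1 :: p.2 :: v := by
      simp [-List.ofFn_succ, ofFn_update, hw, i]
    have hj : (w i.castSucc, w i.succ) = j := by simp [w, i]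
    have hzw : ∑ w', z w' * twoSite i M w' w = 0 := congrFun (hz i) w
    rw [sum_mul_twoSite, hj] at hzw
    simpa [-List.ofFn_succ, ← hupdate, List.ofFn_injective.extend_apply] using hzw
  · refine sum_eq_zero fun i _ => ?_
    rw [Function.extend_apply', Pi.zero_apply, mul_zero]
    rintro ⟨w, hw⟩
    exact hlen (by simpa using (congrArg List.length hw).symm)

lemma HasBiRank.eq_zero_of_mul_twoSite {m n : ℕ} (hm : HasBiRank q R m) (hn : m < n + 1)
    {Z : Matrix (Fin (n + 1) → Fin N) (Fin (n + 1) → Fin N) ℂ}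
    (hZ : ∀ i : Fin n, Z * twoSite i (q⁻¹ • 1 + R) = 0) : Z = 0 := by
  ext v w
  have hrow : Function.extend List.ofFn (Z v) 0 ∈ idealAnnihilator (q⁻¹ • 1 + R) :=
    extend_ofFn_mem_idealAnnihilator fun i => congrFun (hZ i) v
  rw [← List.ofFn_injective.extend_apply (Z v) 0 w]
  exact hm.apply_eq_zero hrow (by rwa [List.length_ofFn])

end Vanishing

/-! ### The tower of a Hecke symmetry -/

section HeckeTower

variable {N : ℕ} {q : ℂ} {R Ψ : Matrix (Fin N × Fin N) (Fin N × Fin N) ℂ} {S : Type*} [Ring S]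
  [Algebra ℂ S]

/-- The operators that commute with all matrix units acting on the letters `k, k + 1, …`. -/
def siteFiltration (N : ℕ) (S : Type*) [Ring S] [Algebra ℂ S] (k : ℕ) : Subalgebra ℂ (Op N S) :=
  Subalgebra.centralizer ℂ {x | ∃ j, k ≤ j ∧ ∃ a b, unitOp S j a b = x}

lemma mem_siteFiltration {k : ℕ} {x : Op N S} :
    x ∈ siteFiltration N S k ↔ ∀ j, k ≤ j → ∀ a b, Commute x (unitOp S j a b) := by
  rw [siteFiltration, Subalgebra.mem_centralizer_iff]
  constructor
  · exact fun h j hj a b => (h _ ⟨j, hj, a, b, rfl⟩).symm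
  · rintro h _ ⟨j, hj, a, b, rfl⟩
    exact (h j hj a b).eq.symm

lemma siteFiltration_mono : Monotone (siteFiltration N S) := fun k l hkl x hx => by
  rw [mem_siteFiltration] at hx ⊢
  exact fun j hj => hx j (hkl.trans hj)

lemma pair_mem_siteFiltration (k : ℕ) (M : Matrix (Fin N × Fin N) (Fin N × Fin N) ℂ) :
    pair (unitOp S) k (k + 1) M ∈ siteFiltration N S (k + 2) :=
  mem_siteFiltration.2 fun _ _ _ _ => (commute_pair
    (fun _ _ => (isCommutingMatrixUnits_unitOp N S).commute (by lia) _ _ _ _)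
    (fun _ _ => (isCommutingMatrixUnits_unitOp N S).commute (by lia) _ _ _ _) _).symm

lemma firstOp_mem_siteFiltration (L : Matrix (Fin N) (Fin N) S) :
    firstOp L ∈ siteFiltration N S 1 :=
  mem_siteFiltration.2 fun _ _ _ _ => Commute.sum_left _ _ _ fun _ _ =>
    Commute.sum_left _ _ _ fun _ _ => (commute_mulOp_unitOp _ _ _ _).mul_left
      ((isCommutingMatrixUnits_unitOp N S).commute (by lia) _ _ _ _)

lemma weightedTrace_mem_siteFiltration (C : Matrix (Fin N) (Fin N) ℂ) {k : ℕ} {x : Op N S}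
    (hx : x ∈ siteFiltration N S (k + 1)) :
    weightedTrace (unitOp S) C k x ∈ siteFiltration N S k := by
  have he := isCommutingMatrixUnits_unitOp N S
  rw [mem_siteFiltration] at hx ⊢
  intro j hj a b
  rcases hj.eq_or_lt with rfl | hj
  · exact (he.commute_unit_weightedTrace _ _ _ _ _).symm
  · exact (commute_weightedTrace (fun _ _ => he.commute hj.ne' _ _ _ _)
      (hx j hj a b).symm _).symm

lemma commute_pair_of_mem_siteFiltration {k : ℕ} {x : Op N S} (hx : x ∈ siteFiltration N S k)
    (M : Matrix (Fin N × Fin N) (Fin N × Fin N) ℂ) :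
    Commute (pair (unitOp S) k (k + 1) M) x :=
  (commute_pair (mem_siteFiltration.1 hx k le_rfl)
    (mem_siteFiltration.1 hx (k + 1) k.le_succ) M).symm

variable (S) in
/-- The matrix `R` acting on the letters `k` and `k + 1`. -/
noncomputable def braidOp (hq0 : q ≠ 0) (hR : IsHeckeSymmetry q R) (k : ℕ) : (Op N S)ˣ where
  val := pair (unitOp S) k (k + 1) R
  inv := pair (unitOp S) k (k + 1) R⁻¹
  val_inv := by
    have he := isCommutingMatrixUnits_unitOp N S
    rw [← he.pair_mul k.succ_ne_self.symm, hR.mul_inv hq0, he.pair_one k.succ_ne_self.symm]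
  inv_val := by
    have he := isCommutingMatrixUnits_unitOp N S
    rw [← he.pair_mul k.succ_ne_self.symm, hR.inv_mul hq0, he.pair_one k.succ_ne_self.symm]

lemma val_braidOp (hq0 : q ≠ 0) (hR : IsHeckeSymmetry q R) (k : ℕ) :
    (braidOp S hq0 hR k : Op N S) = pair (unitOp S) k (k + 1) R := rfl

lemma val_inv_braidOp (hq0 : q ≠ 0) (hR : IsHeckeSymmetry q R) (k : ℕ) :
    (↑(braidOp S hq0 hR k)⁻¹ : Op N S) = pair (unitOp S) k (k + 1) R⁻¹ := rfl

lemma val_braidOp_zpow (hq0 : q ≠ 0) (hR : IsHeckeSymmetry q R) (ε : ℤˣ) (k : ℕ) :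
    ((braidOp S hq0 hR k ^ (ε : ℤ) : (Op N S)ˣ) : Op N S) =
      pair (unitOp S) k (k + 1) (R ^ (ε : ℤ)) := by
  rcases Int.units_eq_one_or ε with rfl | rfl
  · simp [val_braidOp]
  · simp [val_inv_braidOp, Matrix.zpow_neg_one]

lemma isHeckeRep_braidOp (hq0 : q ≠ 0) (hR : IsHeckeSymmetry q R) :
    IsHeckeRep q (braidOp S hq0 hR) where
  braid k := by
    have hf : Function.Injective fun i : Fin 3 => k + (i : ℕ) := fun i j hij =>
      Fin.ext (Nat.add_left_cancel hij)
    have hbraid := congrArg (fun M => matOp (S := S) _ hf (M.map (algebraMap ℂ S))) hR.braid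
    simp only [Matrix.map_mul, map_mul, matOp_twoSite] at hbraid
    exact Units.ext hbraid
  commute hij := Units.ext (commute_pair_of_mem_siteFiltration
    (siteFiltration_mono hij (pair_mem_siteFiltration _ R)) R)
  mul_self k := by
    have he := isCommutingMatrixUnits_unitOp N S
    simp only [val_braidOp]
    rw [← he.pair_mul k.succ_ne_self.symm, hR.mul_self hq0, map_add, map_smul,
      he.pair_one k.succ_ne_self.symm]

lemma isReflectionTower (hq0 : q ≠ 0) (hR : IsHeckeSymmetry q R) (hΨ : IsSkewInverse R Ψ)
    {L : Matrix (Fin N) (Fin N) S}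
    (hL : pair (unitOp S) 0 1 R * firstOp L * pair (unitOp S) 0 1 R * firstOp L =
      firstOp L * pair (unitOp S) 0 1 R * firstOp L * pair (unitOp S) 0 1 R) :
    IsReflectionTower (siteFiltration N S) (weightedTrace (unitOp S) (traceMatrix Ψ))
      (braidOp S hq0 hR) (firstOp L) where
  mono := siteFiltration_mono
  trace_mem := weightedTrace_mem_siteFiltration _
  trace_mul_left hy := weightedTrace_mul_of_commute (mem_siteFiltration.1 hy _ le_rfl) _
  trace_mul_right hy := weightedTrace_mul_of_commute' (mem_siteFiltration.1 hy _ le_rfl) _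
  braid_mem k := (Submonoid.mem_units_iff _ _).2
    ⟨pair_mem_siteFiltration k R, pair_mem_siteFiltration k R⁻¹⟩
  commute_of_mem hx := commute_pair_of_mem_siteFiltration hx R
  trace_conj hx := (isCommutingMatrixUnits_unitOp N S).weightedTrace_pair_mul_mul_pair
    (Nat.succ_ne_self _).symm (hR.rightTrace_mul_mul_inv hq0 hΨ)
    (mem_siteFiltration.1 hx _ le_rfl)
  trace_trace_mul_comm k := (isCommutingMatrixUnits_unitOp N S).weightedTrace_weightedTrace_pair_mul
    k.succ_ne_self.symm (hR.commute_traceMatrix_kronecker hq0 hΨ)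
  braid := (isHeckeRep_braidOp hq0 hR).braid
  l_mem := firstOp_mem_siteFiltration L
  reflection := hL

end HeckeTower

/-! ### The reflection equation algebra -/

section REAlgebra

variable {N : ℕ} {q : ℂ} {R Ψ : Matrix (Fin N × Fin N) (Fin N × Fin N) ℂ}

lemma reflection_genL_kronecker (R : Matrix (Fin N × Fin N) (Fin N × Fin N) ℂ) :
    scal R R * (genL R ⊗ₖ 1) * scal R R * (genL R ⊗ₖ 1) =
      (genL R ⊗ₖ 1) * scal R R * (genL R ⊗ₖ 1) * scal R R := by
  have hscal : (R.map (algebraMap ℂ (FreeAlgebra ℂ (Fin N × Fin N)))).map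
      (RingQuot.mkAlgHom ℂ (RERel R)) = scal R R := by
    ext i j
    simp only [scal, Matrix.map_apply, AlgHom.commutes]
  have hgenL : (freeL N).map (RingQuot.mkAlgHom ℂ (RERel R)) = genL R ⊗ₖ 1 := by
    ext i j
    simp only [freeL, genL, Matrix.map_apply, Matrix.kroneckerMap_apply, Matrix.of_apply,
      map_mul, Matrix.one_apply, apply_ite (RingQuot.mkAlgHom ℂ (RERel R)), map_one, map_zero]
  rw [← hscal, ← hgenL]
  simp only [← Matrix.map_mul]
  ext i j
  exact RingQuot.mkAlgHom_rel ℂ (RERel.of i j)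

lemma twoSite_zero_map {S : Type*} [Semiring S] [Algebra ℂ S]
    (R : Matrix (Fin N × Fin N) (Fin N × Fin N) ℂ) :
    (twoSite (0 : Fin 1) R).map (algebraMap ℂ S) = (R.map (algebraMap ℂ S)).submatrix
      (finTwoArrowEquiv (Fin N)) (finTwoArrowEquiv (Fin N)) := by
  ext v w
  simp [twoSite, Fin.forall_fin_two, finTwoArrowEquiv]

lemma oneSite_zero_eq_submatrix {S : Type*} [Semiring S] (L : Matrix (Fin N) (Fin N) S) :
    oneSite (0 : Fin 2) L = (L ⊗ₖ 1).submatrix (finTwoArrowEquiv (Fin N))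
      (finTwoArrowEquiv (Fin N)) := by
  ext v w
  simp [oneSite, Fin.forall_fin_two, finTwoArrowEquiv, Matrix.one_apply]

lemma reflection_firstOp_genL (R : Matrix (Fin N × Fin N) (Fin N × Fin N) ℂ) :
    pair (unitOp (REAlgebra R)) 0 1 R * firstOp (genL R) * pair (unitOp (REAlgebra R)) 0 1 R *
      firstOp (genL R) = firstOp (genL R) * pair (unitOp (REAlgebra R)) 0 1 R *
      firstOp (genL R) * pair (unitOp (REAlgebra R)) 0 1 R := by
  have hpair : matOp Fin.val Fin.val_injective ((scal R R).submatrix (finTwoArrowEquiv (Fin N))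
      (finTwoArrowEquiv (Fin N))) = pair (unitOp (REAlgebra R)) 0 1 R := by
    rw [scal, ← twoSite_zero_map, matOp_twoSite]
    rfl
  have hfirst : matOp Fin.val Fin.val_injective ((genL R ⊗ₖ 1).submatrix
      (finTwoArrowEquiv (Fin N)) (finTwoArrowEquiv (Fin N))) = firstOp (genL R) := by
    rw [← oneSite_zero_eq_submatrix, matOp_oneSite (n := 1) _ _ rfl]
  simp only [← hpair, ← hfirst, ← map_mul, Matrix.submatrix_mul_equiv,
    reflection_genL_kronecker R]

/-- The complex matrices on `V^{⊗n}` acting on the letters `0, …, n - 1`. -/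
noncomputable def scalOp (N : ℕ) (S : Type*) [Ring S] [Algebra ℂ S] (n : ℕ) :
    Matrix (Fin n → Fin N) (Fin n → Fin N) ℂ →ₐ[ℂ] Op N S :=
  (matOp Fin.val Fin.val_injective).comp (Algebra.ofId ℂ S).mapMatrix

section scalOp

variable {S : Type*} [Ring S] [Algebra ℂ S]

lemma scalOp_apply {n : ℕ} (M : Matrix (Fin n → Fin N) (Fin n → Fin N) ℂ) :
    scalOp N S n M = matOp Fin.val Fin.val_injective (M.map (algebraMap ℂ S)) := rfl

lemma scalOp_injective [Nontrivial S] [Nonempty (Fin N)] (n : ℕ) :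
    Function.Injective (scalOp N S n) :=
  (matOp_injective _ Fin.val_injective).comp (Matrix.map_injective (algebraMap ℂ S).injective)

lemma scalOp_twoSite {n : ℕ} (i : Fin n) (M : Matrix (Fin N × Fin N) (Fin N × Fin N) ℂ) :
    scalOp N S (n + 1) (twoSite i M) = pair (unitOp S) i (i + 1) M := by
  rw [scalOp_apply, matOp_twoSite, Fin.val_castSucc, Fin.val_succ]

lemma scalOp_antisymm (hq0 : q ≠ 0) (hR : IsHeckeSymmetry q R) (n : ℕ) (i : Fin (n + 1)) :
    scalOp N S (n + 1) (antisymm q R n i) = antisymmetrizer q (braidOp S hq0 hR) i := by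
  induction i using Fin.induction with
  | zero => exact map_one _
  | succ i ih =>
    simp only [antisymm, Fin.induction_succ] at ih ⊢
    rw [map_smul, map_mul, map_mul, ih, map_sub, map_smul, map_smul, map_one, scalOp_twoSite]
    rfl

lemma scalOp_prod_twoSite_zpow (hq0 : q ≠ 0) (hR : IsHeckeSymmetry q R) (ε : ℤˣ) (n : ℕ) :
    scalOp N S (n + 1) (List.ofFn fun i : Fin n => twoSite i (R ^ (ε : ℤ))).reverse.prod =
      (↑(descProd (braidOp S hq0 hR ^ (ε : ℤ)) 0 n) : Op N S) := by
  rw [map_list_prod, List.map_reverse, List.map_ofFn, val_descProd, ← prod_reverse_ofFn]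
  simp only [Function.comp_def, scalOp_twoSite, Pi.pow_apply, val_braidOp_zpow]

end scalOp

/-! ### Characteristic elements as brackets -/

lemma matOp_barL (hq0 : q ≠ 0) (hR : IsHeckeSymmetry q R) (n : ℕ) (i : Fin (n + 1)) :
    matOp Fin.val Fin.val_injective (barL R n i) =
      copyL (braidOp (REAlgebra R) hq0 hR) (firstOp (genL R)) i := by
  induction i using Fin.induction with
  | zero => exact matOp_oneSite _ _ rfl _
  | succ i ih =>
    simp only [barL, Fin.induction_succ] at ih ⊢
    rw [map_mul, map_mul, ih, scal, scal, ← scalOp_apply, ← scalOp_apply, scalOp_twoSite,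
      scalOp_twoSite]
    rfl

lemma matOp_barLProd (hq0 : q ≠ 0) (hR : IsHeckeSymmetry q R) (n : ℕ) :
    matOp Fin.val Fin.val_injective (barLProd R n) =
      prodL (braidOp (REAlgebra R) hq0 hR) (firstOp (genL R)) 0 (n + 1) := by
  rw [barLProd, map_list_prod, List.map_ofFn, ← prod_ofFn_copyL]
  simp only [Function.comp_def, matOp_barL hq0 hR]

lemma mulOp_charElt (hq0 : q ≠ 0) (hR : IsHeckeSymmetry q R) {n : ℕ}
    (Z : Matrix (Fin (n + 1) → Fin N) (Fin (n + 1) → Fin N) ℂ) :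
    mulOp N (REAlgebra R) (charElt R Ψ Z) =
      bracket (weightedTrace (unitOp (REAlgebra R)) (traceMatrix Ψ))
        (braidOp (REAlgebra R) hq0 hR) (firstOp (genL R)) (n + 1)
        (scalOp N (REAlgebra R) (n + 1) Z) := by
  rw [charElt, scal, ← iterTrace_weightedTrace_matOp, bracket_apply, map_mul,
    matOp_barLProd hq0 hR]
  rfl

lemma charElt_of_isEmpty [IsEmpty (Fin N)] {n : ℕ}
    (Z : Matrix (Fin (n + 1) → Fin N) (Fin (n + 1) → Fin N) ℂ) : charElt R Ψ Z = 0 := by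
  simp [charElt, Matrix.trace]

/-- The power sums of both kinds at once: `powerSum` for `ε = 1` and `powerSum'` for `ε = -1`. -/
noncomputable def signedPowerSum (R Ψ : Matrix (Fin N × Fin N) (Fin N × Fin N) ℂ) (ε : ℤˣ) :
    ℕ → REAlgebra R
  | 0 => 0
  | n + 1 => charElt R Ψ (List.ofFn fun i : Fin n => twoSite i (R ^ (ε : ℤ))).reverse.prod

lemma signedPowerSum_one : signedPowerSum R Ψ 1 = powerSum R Ψ := by
  funext k
  cases k <;> simp [signedPowerSum, powerSum]

lemma signedPowerSum_neg_one : signedPowerSum R Ψ (-1) = powerSum' R Ψ := by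
  funext k
  cases k <;> simp [signedPowerSum, powerSum', Matrix.zpow_neg_one]

lemma mulOp_elemSymm (hq0 : q ≠ 0) (hR : IsHeckeSymmetry q R) (k : ℕ) :
    mulOp N (REAlgebra R) (elemSymm q R Ψ k) =
      elemBracket q (weightedTrace (unitOp (REAlgebra R)) (traceMatrix Ψ))
        (braidOp (REAlgebra R) hq0 hR) (firstOp (genL R)) k := by
  cases k with
  | zero => exact map_one _
  | succ n => rw [elemSymm, mulOp_charElt hq0 hR, scalOp_antisymm hq0 hR]; rfl

lemma mulOp_signedPowerSum (hq0 : q ≠ 0) (hR : IsHeckeSymmetry q R) (ε : ℤˣ) (k : ℕ) :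
    mulOp N (REAlgebra R) (signedPowerSum R Ψ ε k) =
      powerBracket ε (weightedTrace (unitOp (REAlgebra R)) (traceMatrix Ψ))
        (braidOp (REAlgebra R) hq0 hR) (firstOp (genL R)) k := by
  cases k with
  | zero => exact map_zero _
  | succ n => rw [signedPowerSum, mulOp_charElt hq0 hR, scalOp_prod_twoSite_zpow hq0 hR]; rfl

theorem newton_elemSymm (hq0 : q ≠ 0) (hq : ∀ k : ℕ, 1 ≤ k → q ^ k ≠ 1)
    (hR : IsHeckeSymmetry q R) (hΨ : IsSkewInverse R Ψ) (ε : ℤˣ) (k : ℕ) :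
    qNum q (k + 1) • elemSymm q R Ψ (k + 1) = ∑ i ∈ range (k + 1),
      ((-1) ^ (k - i) * (q ^ (ε : ℤ)) ^ i) •
        (elemSymm q R Ψ i * signedPowerSum R Ψ ε (k + 1 - i)) := by
  cases isEmpty_or_nonempty (Fin N)
  · have hzero (n : ℕ) : signedPowerSum R Ψ ε n = 0 := by
      cases n <;> simp [signedPowerSum, charElt_of_isEmpty]
    simp [hzero, elemSymm, charElt_of_isEmpty]
  · apply mulOp_injective (N := N)
    simp only [map_sum, map_smul, map_mul, mulOp_elemSymm hq0 hR, mulOp_signedPowerSum hq0 hR]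
    exact (isReflectionTower hq0 hR hΨ (reflection_firstOp_genL R)).newton_elemBracket hq0 hq
      (isHeckeRep_braidOp hq0 hR) ε k

lemma antisymm_last_mul_twoSite (hq0 : q ≠ 0) (hq : ∀ k : ℕ, 1 ≤ k → q ^ k ≠ 1)
    (hR : IsHeckeSymmetry q R) {n : ℕ} (i : Fin n) :
    antisymm q R n (Fin.last n) * twoSite i (q⁻¹ • 1 + R) = 0 := by
  cases isEmpty_or_nonempty (Fin N)
  · exact Subsingleton.elim _ _
  · apply scalOp_injective (S := ℂ)
    rw [map_mul, map_zero, scalOp_antisymm hq0 hR, scalOp_twoSite, map_add, map_smul,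
      (isCommutingMatrixUnits_unitOp N ℂ).pair_one (Nat.succ_ne_self _).symm,
      ← val_braidOp hq0 hR, mul_add, Fin.val_last,
      (isHeckeRep_braidOp hq0 hR).antisymmetrizer_mul_of_lt hq0 hq i.isLt]
    simp

theorem elemSymm_eq_zero (hq0 : q ≠ 0) (hq : ∀ k : ℕ, 1 ≤ k → q ^ k ≠ 1)
    (hR : IsHeckeSymmetry q R) {m k : ℕ} (hm : HasBiRank q R m) (hk : m < k) :
    elemSymm q R Ψ k = 0 := by
  obtain ⟨n, rfl⟩ : ∃ n, k = n + 1 := ⟨k - 1, by lia⟩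
  rw [elemSymm, hm.eq_zero_of_mul_twoSite hk (antisymm_last_mul_twoSite hq0 hq hR)]
  simp [charElt, scal]

end REAlgebra

/-! ### Generating functions -/

section Generating

variable {K ι : Type*} [CommRing K] [Fintype ι]

lemma coeff_prod_lin (ν : ι → K) (k : ℕ) :
    PowerSeries.coeff k (∏ i, lin (ν i)) =
      (-1) ^ k * ∑ s ∈ powersetCard k univ, ∏ i ∈ s, ν i := by
  have hlin (i : ι) : lin (ν i) = 1 + PowerSeries.C (-ν i) * PowerSeries.X := by
    simp [lin, sub_eq_add_neg]
  have hcoeff (s : Finset ι) : PowerSeries.coeff k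
      (∏ i ∈ s, PowerSeries.C (-ν i) * PowerSeries.X) =
      if #s = k then (-1) ^ k * ∏ i ∈ s, ν i else 0 := by
    rw [prod_mul_distrib, ← map_prod, prod_const, prod_neg, PowerSeries.coeff_C_mul,
      PowerSeries.coeff_X_pow]
    grind
  simp only [hlin, prod_one_add, map_sum, hcoeff]
  rw [← sum_filter, ← mul_sum, ← powersetCard_eq_filter]

lemma prod_lin_mul_prod_linInv (ν : ι → K) : (∏ i, lin (ν i)) * ∏ i, linInv (ν i) = 1 := by
  simp only [← prod_mul_distrib, lin_mul_linInv, prod_const_one]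

lemma eq_map_prod_lin_mul_linInv {E : Type*} [Semiring E] (ψ : K →+* E) {ν ρ : ι → K}
    {f : PowerSeries E}
    (hf : PowerSeries.map ψ (∏ i, lin (ν i)) * f = PowerSeries.map ψ (∏ i, lin (ρ i))) :
    f = PowerSeries.map ψ (∏ i, lin (ρ i) * linInv (ν i)) := by
  rw [prod_mul_distrib, mul_comm, map_mul, ← hf, ← mul_assoc, ← map_mul, mul_comm (∏ i, linInv _),
    prod_lin_mul_prod_linInv, map_one, one_mul]

variable {E : Type*} [Ring E] [Algebra ℂ E] [Algebra ℂ K] {ψ : K →ₐ[ℂ] E} {q : ℂ} {ν : ι → K}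
  {a p : ℕ → E}

lemma coeff_map_prod_lin_smul
    (ha : ∀ k, q ^ k • a k = ψ (∑ s ∈ powersetCard k univ, ∏ i ∈ s, ν i)) (u : ℂ) (k : ℕ) :
    PowerSeries.coeff k (PowerSeries.map ψ.toRingHom (∏ i, lin (u • ν i))) =
      ((-1) ^ k * (u * q) ^ k) • a k := by
  have hsmul : ∑ s ∈ powersetCard k (univ : Finset ι), ∏ i ∈ s, u • ν i =
      u ^ k • ∑ s ∈ powersetCard k univ, ∏ i ∈ s, ν i := by
    rw [smul_sum]
    refine sum_congr rfl fun s hs => ?_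
    rw [prod_smul, prod_const, (mem_powersetCard.mp hs).2]
  have hneg : (-1 : K) ^ k = algebraMap ℂ K ((-1) ^ k) := by simp
  rw [PowerSeries.coeff_map, coeff_prod_lin, hsmul, hneg, ← Algebra.smul_def, mul_pow, mul_smul,
    mul_smul, ha, ← map_smul, ← map_smul]
  rfl

lemma prod_lin_mul_smul_mk (hq0 : q ≠ 0) (hω : q - q⁻¹ ≠ 0) (hp : p 0 = 0)
    (ha : ∀ k, q ^ k • a k = ψ (∑ s ∈ powersetCard k univ, ∏ i ∈ s, ν i)) (v : ℂ)
    (hnewton : ∀ k, qNum q (k + 1) • a (k + 1) = ∑ i ∈ range (k + 1),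
      ((-1) ^ (k - i) * v ^ i) • (a i * p (k + 1 - i))) :
    PowerSeries.map ψ.toRingHom (∏ i, lin ((v * q⁻¹) • ν i)) * ((q - q⁻¹) • .mk p) =
      PowerSeries.map ψ.toRingHom (∏ i, lin ((q ^ 2)⁻¹ • ν i)) -
        PowerSeries.map ψ.toRingHom (∏ i, lin (ν i)) := by
  have hone : ∏ i, lin (ν i) = ∏ i, lin ((1 : ℂ) • ν i) := by simp only [one_smul]
  have hsq : (q ^ 2)⁻¹ * q = q⁻¹ := by field_simp
  ext k
  rw [hone, map_sub, PowerSeries.coeff_mul, Nat.sum_antidiagonal_eq_sum_range_succ_mk]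
  simp only [coeff_map_prod_lin_smul ha, PowerSeries.coeff_smul, PowerSeries.coeff_mk, hsq,
    inv_mul_cancel_right₀ hq0, one_mul]
  cases k with
  | zero => simp [hp]
  | succ k =>
    have hterm : ∀ i ∈ range (k + 1),
        (((-1) ^ i * v ^ i) • a i) * ((q - q⁻¹) • p (k + 1 - i)) =
          ((-1) ^ k * (q - q⁻¹)) • (((-1) ^ (k - i) * v ^ i) • (a i * p (k + 1 - i))) := by
      intro i hi
      have hsign : (-1 : ℂ) ^ i = (-1) ^ k * (-1) ^ (k - i) := by
        rw [← pow_add, ← Nat.add_sub_assoc (mem_range_succ_iff.mp hi),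
          show k + k - i = i + 2 * (k - i) by grind, pow_add, pow_mul]
        simp
      rw [smul_mul_smul_comm, smul_smul, hsign]
      congr 1
      ring
    rw [sum_range_succ, Nat.sub_self, hp, smul_zero, mul_zero, add_zero, sum_congr rfl hterm,
      ← smul_sum, ← hnewton, smul_smul, mul_assoc, mul_qNum hω, ← sub_smul]
    congr 1
    ring

end Generating

section Spectrum

variable {N m : ℕ} {q : ℂ} {R Ψ : Matrix (Fin N × Fin N) (Fin N × Fin N) ℂ} {E : Type*} [Ring E]
  [Algebra ℂ E] {φ : REAlgebra R →ₐ[ℂ] E} {μ : Fin m → Subalgebra.center ℂ E}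
  (hq0 : q ≠ 0) (hq : ∀ k : ℕ, 1 ≤ k → q ^ k ≠ 1) (hR : IsHeckeSymmetry q R)
  (hm : HasBiRank q R m) (hμ : IsSpectrum q R Ψ φ μ)
include hq0 hq hR hm hμ

lemma IsSpectrum.smul_elemSymm (k : ℕ) :
    q ^ k • φ (elemSymm q R Ψ k) =
      (Subalgebra.center ℂ E).val (∑ s ∈ powersetCard k univ, ∏ i ∈ s, μ i) := by
  rcases k.eq_zero_or_pos with rfl | hk
  · simp [elemSymm]
  rcases le_or_gt k m with hkm | hkm
  · rw [← map_smul]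
    exact hμ k hk hkm
  · rw [elemSymm_eq_zero hq0 hq hR hm hkm, powersetCard_eq_empty.mpr (by simpa using hkm)]
    simp

theorem IsSpectrum.prod_lin_mul_signedPowerSum (hΨ : IsSkewInverse R Ψ) (ε : ℤˣ) :
    PowerSeries.map (Subalgebra.center ℂ E).val.toRingHom
        (∏ i, lin ((q ^ (ε : ℤ) * q⁻¹) • μ i)) *
      ((q - q⁻¹) • PowerSeries.map (φ : REAlgebra R →+* E) (.mk (signedPowerSum R Ψ ε))) =
    PowerSeries.map (Subalgebra.center ℂ E).val.toRingHom (∏ i, lin ((q ^ 2)⁻¹ • μ i)) -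
      PowerSeries.map (Subalgebra.center ℂ E).val.toRingHom (∏ i, lin (μ i)) := by
  have hmk : PowerSeries.map (φ : REAlgebra R →+* E) (.mk (signedPowerSum R Ψ ε)) =
      .mk fun k => φ (signedPowerSum R Ψ ε k) := by
    ext k
    simp
  rw [hmk]
  refine prod_lin_mul_smul_mk hq0 (sub_inv_ne_zero hq0 hq) (map_zero φ)
    (hμ.smul_elemSymm hq0 hq hR hm) _ fun k => ?_
  simpa only [map_sum, map_smul, map_mul] using
    congrArg φ (newton_elemSymm hq0 hq hR hΨ ε k)

end Spectrum

end ReflectionEq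

theorem mainTheorem4 {N m : ℕ} (q : ℂ) (hq0 : q ≠ 0) (hq : ∀ k : ℕ, 1 ≤ k → q ^ k ≠ 1)
    (R Ψ : Matrix (Fin N × Fin N) (Fin N × Fin N) ℂ)
    (hR : ReflectionEq.IsHeckeSymmetry q R)
    (hΨ : ReflectionEq.IsSkewInverse R Ψ)
    (hm : ReflectionEq.HasBiRank q R m)
    {E : Type*} [Ring E] [Algebra ℂ E] (φ : ReflectionEq.REAlgebra R →ₐ[ℂ] E)
    (μ : Fin m → Subalgebra.center ℂ E)
    (hμ : ReflectionEq.IsSpectrum q R Ψ φ μ) :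
    1 + (q - q⁻¹) • PowerSeries.map (φ : ReflectionEq.REAlgebra R →+* E)
          (ReflectionEq.genP R Ψ) =
        PowerSeries.map (Subalgebra.center ℂ E).val.toRingHom
          (∏ i, ReflectionEq.lin ((q ^ 2)⁻¹ • μ i) * ReflectionEq.linInv (μ i)) ∧
      1 - (q - q⁻¹) • PowerSeries.map (φ : ReflectionEq.REAlgebra R →+* E)
          (ReflectionEq.genT R Ψ) =
        PowerSeries.map (Subalgebra.center ℂ E).val.toRingHom
          (∏ i, ReflectionEq.lin (μ i) * ReflectionEq.linInv ((q ^ 2)⁻¹ • μ i)) := by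
  have hnewton := hμ.prod_lin_mul_signedPowerSum hq0 hq hR hm hΨ
  refine ⟨ReflectionEq.eq_map_prod_lin_mul_linInv _ ?_,
    ReflectionEq.eq_map_prod_lin_mul_linInv _ ?_⟩
  · have hP := hnewton 1
    simp only [Units.val_one, zpow_one, mul_inv_cancel₀ hq0, one_smul,
      ReflectionEq.signedPowerSum_one] at hP
    rw [ReflectionEq.genP, mul_add, mul_one, hP, add_sub_cancel]
  · have hT := hnewton (-1)
    simp only [Units.val_neg, Units.val_one, zpow_neg_one, ← sq, inv_pow,
      ReflectionEq.signedPowerSum_neg_one] at hT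
    rw [ReflectionEq.genT, mul_sub, mul_one, hT, sub_sub_cancel]
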